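/- **Theorem (uniform consistency of the MLE in the Thurstone–Mosteller model).** Fix an integer $T\ge 1$. For every $n$ let $p_n\in[0,1]$ and let $\mathbf u=\mathbf u^{(n)}\in\mathbb R^n$ be a score vector with $u_1=0$; let $M_n=\max_{i,j}|u_i-u_j|$. Let $\Phi(y)=\frac1{\sqrt{2\pi}}\int_{-\infty}^y e^{-x^2/2}\,dx$ and $f(1;y)=\Phi(y)$, $f(-1;y)=1-\Phi(y)$. The numbers of comparisons $n_{ij}\sim \mathrm{Bin}(T,p_n)$, $1\le i<j\le n$, are independent and, given them, the outcomes $X_{ij}^{(t)}\in\{-1,1\}$, $1\le t\le n_{ij}$, are independent with mass functions $f(\cdot\,;u_i-u_j)$ (the data for all $n$ live on one probability space, with an arbitrary dependence between different $n$). An MLE is a maximizer $\hat{\mathbf u}$ of $$l(\mathbf v)=\sum_{1\le i<j\le n}\ \sum_{1\le t\le n_{ij}}\log f(X^{(t)}_{ij};v_i-v_j)\quad\text{over } \{\mathbf v\in\mathbb R^n: v_1=0\}.$$ Put $$\rho_n=\sqrt{\frac{\log n}{np_n}}\;\frac{\log n}{\log (np_n)},\qquad \Delta_n=M_n e^{M_n^2}\rho_n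 .$$ There is a constant $C>0$ depending only on $T$ such that the following holds. Suppose that for some constant $c>1$ one has $p_n\ge c\,\frac{\log n}{n}$ for all large $n$, and that, as $n\to\infty$, $$\Delta_n\to0\quad\text{and}\quad \rho_n\to 0$$ (the second condition follows from the first when $M_n$ is bounded away from $0$). Then the MLE is uniformly consistent: 1. for all sufficiently large $n$, with probability at least $1-14n^{-2}$, the MLE $\hat{\mathbf u}$ exists, is unique, and satisfies $\|\hat{\mathbf u}-\mathbf u\|_\infty\le C(\Delta_n+\rho_n)$ (so $\|\hat{\mathbf u}-\mathbf u\|_\infty\lesssim\Delta_n$ when $M_n$ is bounded away from $0$); 2. almost surely, the MLE exists, is unique and satisfies this bound for all but finitely many $n$; 3. in particular, $\|\hat{\mathbf u}-\mathbf u\|_\infty\to0$ almost surely. -/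

import Mathlib

open MeasureTheory ProbabilityTheory Filter Topology

noncomputable section

namespace PairwiseComparison

/-- The standard normal distribution function (the probit link). -/
def probit (y : ℝ) : ℝ :=
  (1 / Real.sqrt (2 * Real.pi)) * ∫ x in Set.Iic y, Real.exp (-(x ^ 2) / 2)

/-- The Thurstone-Mosteller mass function on the outcome set `{-1, 1}` (and `0` elsewhere):
`f(1; y) = Φ(y)` and `f(-1; y) = 1 - Φ(y)`. -/
def tmMass (x : ℤ) (y : ℝ) : ℝ :=
  if x = 1 then probit y else if x = -1 then 1 - probit y else 0

/-- The law on `{-1, 1}` with mass function `f(·; y)`. -/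
def tmLaw (y : ℝ) : Measure ℤ :=
  ENNReal.ofReal (tmMass 1 y) • Measure.dirac 1 +
    ENNReal.ofReal (tmMass (-1) y) • Measure.dirac (-1)

/-- The unordered pairs of distinct subjects, represented as `(i, j)` with `i < j`. -/
abbrev Pair (n : ℕ) : Type := {e : Fin n × Fin n // e.1 < e.2}

/-- The relative score `v_i - v_j` of the pair `e = (i, j)`. -/
def relScore {n : ℕ} (v : Fin n → ℝ) (e : Pair n) : ℝ := v e.1.1 - v e.1.2

/-- The first subject is normalised to have score `0` (no condition if `n = 0`). -/
def FirstZero {n : ℕ} (v : Fin n → ℝ) : Prop := ∀ i : Fin n, (i : ℕ) = 0 → v i = 0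

/-- The dynamic range `max_{i,j} |u_i - u_j|`. -/
def dynamicRange {n : ℕ} (u : Fin n → ℝ) : ℝ := ⨆ e : Fin n × Fin n, |u e.1 - u e.2|

/-- Comparison data from the Thurstone-Mosteller model with scores `u`. The number of comparisons
`N e` of each pair `e = (i, j)` is `Bin(T, p)`; the outcome `X e t` of the `t`-th comparison
(counted from `0`) of `e` has law `f(·; u_i - u_j)`; all these variables are independent.
Only the outcomes `X e t` with `t < N e` are observed, so that, conditionally on the
numbers of comparisons, the observed outcomes are independent with laws `f(·; u_i - u_j)`. -/
structure IsTMData {Ω : Type*} [MeasurableSpace Ω] (μ : Measure Ω) (T : ℕ) (p : unitInterval)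
    {n : ℕ} (u : Fin n → ℝ) (N : Pair n → Ω → ℕ) (X : Pair n → Fin T → Ω → ℤ) : Prop where
  law_count : ∀ e, HasLaw (N e) (binomial T p) μ
  law_outcome : ∀ e t, HasLaw (X e t) (tmLaw (relScore u e)) μ
  indep : iIndepFun (β := fun _ : Pair n ⊕ (Pair n × Fin T) => ℤ)
    (Sum.elim (fun e ω => (N e ω : ℤ)) (fun q ω => X q.1 q.2 ω)) μ

/-- The conditional log-likelihood
`l(v) = ∑_{i < j} ∑_{t < n_{ij}} log f(X_{ij}^{(t)}; v_i - v_j)` of observed data. -/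
def logLik {T n : ℕ} (N : Pair n → ℕ) (X : Pair n → Fin T → ℤ) (v : Fin n → ℝ) : ℝ :=
  ∑ e : Pair n, ∑ t : Fin T,
    if (t : ℕ) < N e then Real.log (tmMass (X e t) (relScore v e)) else 0

/-- `v` maximises the log-likelihood over the score vectors whose first entry is `0`. -/
def IsMLE {T n : ℕ} (N : Pair n → ℕ) (X : Pair n → Fin T → ℤ) (v : Fin n → ℝ) : Prop :=
  FirstZero v ∧ ∀ w : Fin n → ℝ, FirstZero w → logLik N X w ≤ logLik N X v

/-- The MLE exists, is unique, and lies within distance `r` of `u` in the sup norm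
(which is the norm of `Fin n → ℝ`). -/
def MLEUniqueWithin {T n : ℕ} (N : Pair n → ℕ) (X : Pair n → Fin T → ℤ) (u : Fin n → ℝ)
    (r : ℝ) : Prop :=
  (∃! v, IsMLE N X v) ∧ ∀ v, IsMLE N X v → ‖v - u‖ ≤ r

/-- `sqrt(log n / (n p)) * (log n / log (n p))`. -/
def sparsityRate (n : ℕ) (p : ℝ) : ℝ :=
  Real.sqrt (Real.log n / (n * p)) * (Real.log n / Real.log (n * p))

/-- `Δ = M exp(M ^ 2) sqrt(log n / (n p)) * (log n / log (n p))`. -/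
def tmRate (n : ℕ) (p M : ℝ) : ℝ := M * Real.exp (M ^ 2) * sparsityRate n p

end PairwiseComparison

end

/-! The log-likelihood is concave because `Φ` is log-concave, and its curvature at relative scores
in `[-(M+1), M+1]` is at least `κ = minCurvature M`, of order `exp(-(M+3)^2/2)`. The error is
controlled by a chaining argument on superlevel sets rather than by inverting a Hessian.

Let `f = ±(v - u)`, with `v` an MLE, and let `A = {f ≥ c}` and `A' = {f ≥ c - b}`. Differentiate the
likelihood in the direction of the indicator of `A`, and compare the values at `u` and at `v`. Pairs
inside `A` or outside `A` cancel, pairs leaving `A` contribute with one sign, and each compared pair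
from `A` to the complement of `A'` contributes at least `κ b`
(`minCurvature_mul_card_comparedPairs_le`). Since the derivative at `v` vanishes, the number of such
pairs is at most `z * #A / (κ b)`, where `z` bounds the score of each subject at `u`. If the
comparison graph expands and `b` is large enough, this forces `A'` to exceed half of the subjects or
to exceed `A` by a factor `G`. After `k ≈ log n / log G` steps a majority is reached
(`pow_le_card_superlevel`). The majorities obtained from `f` and from `-f` intersect, so the error
oscillates by at most `2 k b` (`error_sub_error_le`). The same estimate gives uniqueness, by letting
`b` tend to `0`, and existence, through a vanishing quadratic penalty.

Two probabilistic facts remain. Chernoff bounds give `z` of order `exp(M) sqrt(n p log n)`, and a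
weighted union bound gives expansion with `G = n p / (64 log n)` and `L = n p / 8`. Hence `b` is of
order `exp(M^2) sqrt(log n / (n p))` and `k` of order `log n / log (n p)`, whose product is the
rate. Borel–Cantelli yields the almost sure statements. -/

noncomputable section

namespace PairwiseComparison

/-! ### The standard normal density and distribution function -/

/-- The standard normal density. -/
def normalDensity (y : ℝ) : ℝ := (1 / Real.sqrt (2 * Real.pi)) * Real.exp (-(y ^ 2) / 2)

lemma normalDensity_pos (y : ℝ) : 0 < normalDensity y := by
  unfold normalDensity; positivity

lemma normalDensity_neg (y : ℝ) : normalDensity (-y) = normalDensity y := by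
  simp [normalDensity]

lemma normalDensity_le_of_abs_le {x y : ℝ} (h : |x| ≤ |y|) :
    normalDensity y ≤ normalDensity x := by
  unfold normalDensity
  have := sq_le_sq.2 h
  gcongr

lemma hasDerivAt_normalDensity (y : ℝ) :
    HasDerivAt normalDensity (-y * normalDensity y) y := by
  have h : HasDerivAt (fun x : ℝ => -(x ^ 2) / 2) (-y) y := by
    have := ((hasDerivAt_pow 2 y).neg).div_const 2
    convert! this using 1
    push_cast; ring
  have h2 := (h.exp).const_mul (1 / Real.sqrt (2 * Real.pi))
  convert! h2 using 1
  unfold normalDensity; ring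

lemma continuous_normalDensity : Continuous normalDensity := by
  unfold normalDensity; fun_prop

lemma integrable_normalDensity : Integrable normalDensity := by
  unfold normalDensity
  refine Integrable.const_mul ?_ _
  convert! integrable_exp_neg_mul_sq (b := 1 / 2) (by norm_num) using 3
  ring

lemma integrable_mul_normalDensity : Integrable fun x => x * normalDensity x := by
  have := (integrable_mul_exp_neg_mul_sq (b := 1 / 2) (by norm_num)).const_mul
    (1 / Real.sqrt (2 * Real.pi))
  convert! this using 2 with x
  unfold normalDensity
  rw [show -(x ^ 2) / 2 = -(1 / 2) * x ^ 2 by ring]; ring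

lemma integral_normalDensity : ∫ x, normalDensity x = 1 := by
  unfold normalDensity
  rw [integral_const_mul]
  have h : ∀ x : ℝ, Real.exp (-(x ^ 2) / 2) = Real.exp (-(1 / 2) * x ^ 2) := by
    intro x; congr 1; ring
  simp_rw [h]
  rw [integral_gaussian, show Real.pi / (1 / 2) = 2 * Real.pi by ring]
  have : Real.sqrt (2 * Real.pi) ≠ 0 := by positivity
  field_simp

lemma probit_eq_setIntegral (y : ℝ) : probit y = ∫ x in Set.Iic y, normalDensity x := by
  unfold probit normalDensity
  rw [integral_const_mul]

lemma probit_neg (y : ℝ) : probit (-y) = 1 - probit y := by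
  have h1 := integral_comp_neg_Iic (-y) normalDensity
  simp_rw [normalDensity_neg, neg_neg] at h1
  have h2 := intervalIntegral.integral_Iic_add_Ioi (b := y) (f := normalDensity)
    integrable_normalDensity.integrableOn integrable_normalDensity.integrableOn
  rw [integral_normalDensity] at h2
  rw [probit_eq_setIntegral, probit_eq_setIntegral, h1]
  linarith

lemma hasDerivAt_probit (y : ℝ) : HasDerivAt probit (normalDensity y) y := by
  have h : probit = fun y => probit 0 + ∫ x in (0 : ℝ)..y, normalDensity x := by
    funext y
    rw [← intervalIntegral.integral_Iic_sub_Iic integrable_normalDensity.integrableOn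
      integrable_normalDensity.integrableOn, probit_eq_setIntegral, probit_eq_setIntegral]
    ring
  rw [h]
  exact (intervalIntegral.integral_hasDerivAt_right
    integrable_normalDensity.intervalIntegrable
    continuous_normalDensity.stronglyMeasurable.stronglyMeasurableAtFilter
    continuous_normalDensity.continuousAt).const_add _

lemma strictMono_probit : StrictMono probit :=
  strictMono_of_deriv_pos fun y => by
    rw [(hasDerivAt_probit y).deriv]; exact normalDensity_pos y

lemma probit_nonneg (y : ℝ) : 0 ≤ probit y := by
  rw [probit_eq_setIntegral]
  exact integral_nonneg fun x => (normalDensity_pos x).le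

lemma probit_pos (y : ℝ) : 0 < probit y :=
  (probit_nonneg (y - 1)).trans_lt (strictMono_probit (by linarith))

lemma probit_lt_one (y : ℝ) : probit y < 1 := by
  have := probit_pos (-y)
  rw [probit_neg] at this
  linarith

lemma continuous_probit : Continuous probit :=
  continuous_iff_continuousAt.2 fun y => (hasDerivAt_probit y).continuousAt

/-- Mean value theorem on `[-s - 1, -s]`, where the density is smallest at the far endpoint. -/
lemma normalDensity_add_one_le_probit_neg {s : ℝ} (hs : 0 ≤ s) :
    normalDensity (s + 1) ≤ probit (-s) := by
  obtain ⟨c, hc, hc'⟩ := exists_hasDerivAt_eq_slope probit normalDensity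
    (a := -s - 1) (b := -s) (by linarith) continuous_probit.continuousOn
    (fun x _ => hasDerivAt_probit x)
  have h1 := probit_nonneg (-s - 1)
  have h2 : normalDensity (s + 1) ≤ normalDensity c := by
    apply normalDensity_le_of_abs_le
    rw [abs_of_nonneg (by linarith : 0 ≤ s + 1), abs_le]
    constructor <;> linarith [hc.1, hc.2]
  rw [show -s - (-s - 1) = 1 by ring, div_one] at hc'
  linarith

/-- The integrated normal distribution function `y Φ(y) + φ(y)`. -/
def probitPrimitive (y : ℝ) : ℝ := y * probit y + normalDensity y

lemma hasDerivAt_probitPrimitive (y : ℝ) :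
    HasDerivAt probitPrimitive (probit y) y := by
  have := ((hasDerivAt_id y).mul (hasDerivAt_probit y)).add (hasDerivAt_normalDensity y)
  convert! this using 1
  simp

lemma strictMono_probitPrimitive : StrictMono probitPrimitive :=
  strictMono_of_deriv_pos fun y => by
    rw [(hasDerivAt_probitPrimitive y).deriv]; exact probit_pos y

lemma tendsto_normalDensity_atBot : Tendsto normalDensity atBot (𝓝 0) := by
  have h : Tendsto (fun x : ℝ => -(x ^ 2) / 2) atBot atBot := by
    have h1 : Tendsto (fun x : ℝ => x ^ 2) atBot atTop := by
      have := tendsto_pow_atTop (α := ℝ) (n := 2) (by norm_num)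
      have h2 := this.comp (tendsto_neg_atBot_atTop (G := ℝ))
      refine h2.congr fun x => ?_
      simp
    exact (tendsto_neg_atTop_atBot.comp h1).atBot_div_const (by norm_num)
  have := (Real.tendsto_exp_atBot.comp h).const_mul (1 / Real.sqrt (2 * Real.pi))
  rw [mul_zero] at this
  exact this

/-- Makes the positivity of `y Φ(y) + φ(y)` visible; this positivity is the log-concavity of `Φ`. -/
lemma probitPrimitive_eq_setIntegral (y : ℝ) :
    probitPrimitive y = ∫ x in Set.Iic y, (y - x) * normalDensity x := by
  have h1 := integral_Iic_of_hasDerivAt_of_tendsto' (a := y) (m := 0) (f := normalDensity)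
    (f' := fun x => -x * normalDensity x) (fun x _ => hasDerivAt_normalDensity x)
    (by simpa [neg_mul] using integrable_mul_normalDensity.neg.integrableOn)
    tendsto_normalDensity_atBot
  have h2 : ∀ x, (y - x) * normalDensity x = y * normalDensity x + -x * normalDensity x := by
    intro x; ring
  simp_rw [h2]
  rw [integral_add, integral_const_mul, h1, ← probit_eq_setIntegral, sub_zero, probitPrimitive]
  · exact (integrable_normalDensity.const_mul y).integrableOn
  · refine (integrable_mul_normalDensity.neg.congr (ae_of_all _ fun x => ?_)).integrableOn
    simp

lemma probitPrimitive_nonneg (y : ℝ) : 0 ≤ probitPrimitive y := by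
  rw [probitPrimitive_eq_setIntegral]
  refine setIntegral_nonneg measurableSet_Iic fun x hx => ?_
  exact mul_nonneg (sub_nonneg.2 hx) (normalDensity_pos x).le

lemma probitPrimitive_pos (y : ℝ) : 0 < probitPrimitive y :=
  (probitPrimitive_nonneg (y - 1)).trans_lt (strictMono_probitPrimitive (by linarith))

lemma normalDensity_add_two_le_probitPrimitive_neg {s : ℝ} (hs : 0 ≤ s) :
    normalDensity (s + 2) ≤ probitPrimitive (-s) := by
  obtain ⟨c, hc, hc'⟩ := exists_hasDerivAt_eq_slope probitPrimitive probit
    (a := -s - 1) (b := -s) (by linarith)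
    (continuous_iff_continuousAt.2 fun y =>
      (hasDerivAt_probitPrimitive y).continuousAt).continuousOn
    (fun x _ => hasDerivAt_probitPrimitive x)
  have h1 := probitPrimitive_nonneg (-s - 1)
  have h2 := normalDensity_add_one_le_probit_neg (s := s + 1) (by linarith)
  have h3 : probit (-(s + 1)) ≤ probit c := strictMono_probit.monotone (by linarith [hc.1])
  rw [show -s - (-s - 1) = 1 by ring, div_one] at hc'
  rw [show s + 1 + 1 = s + 2 by ring] at h2
  linarith

/-! ### The inverse Mills ratio -/

/-- The inverse Mills ratio `φ / Φ`, the derivative of `log Φ`. -/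
def invMills (y : ℝ) : ℝ := normalDensity y / probit y

lemma invMills_pos (y : ℝ) : 0 < invMills y := div_pos (normalDensity_pos y) (probit_pos y)

/-- The form of the derivative exhibits `-(log Φ)''` as a product of positive factors, each of which
is bounded below separately later. -/
lemma hasDerivAt_invMills (y : ℝ) :
    HasDerivAt invMills (-(invMills y * (probitPrimitive y / probit y))) y := by
  have := (hasDerivAt_normalDensity y).div (hasDerivAt_probit y) (probit_pos y).ne'
  convert! this using 1
  have := (probit_pos y).ne'
  unfold invMills probitPrimitive
  field_simp
  ring

lemma strictAnti_invMills : StrictAnti invMills :=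
  strictAnti_of_deriv_neg fun y => by
    rw [(hasDerivAt_invMills y).deriv, neg_lt_zero]
    exact mul_pos (invMills_pos y) (div_pos (probitPrimitive_pos y) (probit_pos y))

lemma invMills_le {M y : ℝ} (hM : 0 ≤ M) (hy : -M ≤ y) : invMills y ≤ Real.exp (M + 1 / 2) := by
  refine (strictAnti_invMills.antitone hy).trans ?_
  rw [invMills, div_le_iff₀ (probit_pos _), normalDensity_neg]
  calc normalDensity M = Real.exp (M + 1 / 2) * normalDensity (M + 1) := by
        unfold normalDensity
        rw [mul_left_comm, ← Real.exp_add]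
        congr 2; ring
    _ ≤ _ := by
        gcongr
        exact normalDensity_add_one_le_probit_neg hM

/-- A lower bound of the curvature of `log Φ` on the interval `[-(M + 1), M + 1]`. -/
def minCurvature (M : ℝ) : ℝ := normalDensity 0 * normalDensity (M + 3)

lemma minCurvature_pos (M : ℝ) : 0 < minCurvature M :=
  mul_pos (normalDensity_pos _) (normalDensity_pos _)

/-- Dividing by `Φ < 1` only increases a nonnegative quantity. For `y ≥ 0` the small factor is the
density and the primitive is at least `φ(0)`; for `y ≤ 0` the roles are exchanged. -/
lemma minCurvature_le {M y : ℝ} (hM : 0 ≤ M) (hy : |y| ≤ M + 1) :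
    minCurvature M ≤ invMills y * (probitPrimitive y / probit y) := by
  have hle : ∀ a z : ℝ, 0 ≤ a → a ≤ a / probit z := fun a z ha =>
    le_div_self ha (probit_pos z) (probit_lt_one z).le
  have h1 : probitPrimitive y ≤ probitPrimitive y / probit y := hle _ _ (probitPrimitive_nonneg y)
  have h0 := normalDensity_pos 0
  obtain hy0 | hy0 := le_total 0 y
  · have h2 : normalDensity (M + 3) ≤ invMills y := by
      refine le_trans ?_ (hle _ _ (normalDensity_pos y).le)
      apply normalDensity_le_of_abs_le
      rw [abs_of_nonneg (by linarith : 0 ≤ M + 3)]; linarith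
    have h3 : normalDensity 0 ≤ probitPrimitive y := by
      have := strictMono_probitPrimitive.monotone hy0
      simpa [probitPrimitive] using this
    rw [minCurvature, mul_comm]
    exact mul_le_mul h2 (h3.trans h1) h0.le (invMills_pos y).le
  · have h2 : normalDensity 0 ≤ invMills y :=
      (hle _ _ h0.le).trans (strictAnti_invMills.antitone hy0)
    have h3 : normalDensity (M + 3) ≤ probitPrimitive y := by
      have h4 := normalDensity_add_two_le_probitPrimitive_neg (s := M + 1) (by linarith)
      have h5 : probitPrimitive (-(M + 1)) ≤ probitPrimitive y :=
        strictMono_probitPrimitive.monotone (abs_le.1 hy).1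
      rw [show M + 1 + 2 = M + 3 by ring] at h4
      linarith
    exact mul_le_mul h2 (h3.trans h1) (normalDensity_pos _).le (invMills_pos y).le

lemma minCurvature_mul_le_sub {M b y : ℝ} (hM : 0 ≤ M) (hb : 0 ≤ b) (hb1 : b ≤ 1)
    (hy : |y| ≤ M + 1) (hyb : |y + b| ≤ M + 1) :
    minCurvature M * b ≤ invMills y - invMills (y + b) := by
  obtain rfl | hb0 := hb.eq_or_lt
  · simp
  obtain ⟨c, hc, hc'⟩ := exists_hasDerivAt_eq_slope invMills _ (a := y) (b := y + b)
    (by linarith) (continuous_iff_continuousAt.2 fun y =>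
      (hasDerivAt_invMills y).continuousAt).continuousOn (fun x _ => hasDerivAt_invMills x)
  have h := minCurvature_le (M := M) (y := c) hM
    (abs_le.2 ⟨by linarith [hc.1, (abs_le.1 hy).1], by linarith [hc.2, (abs_le.1 hyb).2]⟩)
  rw [show y + b - y = b by ring, eq_div_iff hb0.ne'] at hc'
  nlinarith

/-! ### The score function of the Thurstone-Mosteller model -/

/-- The derivative in `y` of `log f(x; y)`. -/
def score (x : ℤ) (y : ℝ) : ℝ :=
  if x = 1 then invMills y else if x = -1 then -invMills (-y) else 0

lemma score_one (y : ℝ) : score 1 y = invMills y := by simp [score]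

lemma score_neg_one (y : ℝ) : score (-1) y = -invMills (-y) := by simp [score]

lemma tmMass_one (y : ℝ) : tmMass 1 y = probit y := by simp [tmMass]

lemma tmMass_neg_one (y : ℝ) : tmMass (-1) y = probit (-y) := by simp [tmMass, probit_neg]

lemma hasDerivAt_log_tmMass (x : ℤ) (y : ℝ) :
    HasDerivAt (fun y => Real.log (tmMass x y)) (score x y) y := by
  by_cases h1 : x = 1
  · subst h1
    simp_rw [tmMass_one, score_one]
    exact (hasDerivAt_probit y).log (probit_pos y).ne'
  by_cases h2 : x = -1
  · subst h2
    simp_rw [tmMass_neg_one, score_neg_one]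
    have := (HasDerivAt.comp y (hasDerivAt_probit (-y)) (hasDerivAt_neg y)).log
      (probit_pos (-y)).ne'
    convert! this using 1
    unfold invMills
    simp [neg_div]
  · simp only [tmMass, score, h1, h2, if_false, Real.log_zero]
    exact hasDerivAt_const _ _

lemma log_tmMass_nonpos (x : ℤ) (y : ℝ) : Real.log (tmMass x y) ≤ 0 := by
  unfold tmMass
  split_ifs
  · exact Real.log_nonpos (probit_nonneg _) (probit_lt_one _).le
  · exact Real.log_nonpos (by linarith [probit_lt_one y]) (by linarith [probit_pos y])
  · simp

lemma abs_score_le {M y : ℝ} (x : ℤ) (hy : |y| ≤ M) : |score x y| ≤ Real.exp (M + 1 / 2) := by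
  have hM : 0 ≤ M := (abs_nonneg y).trans hy
  unfold score
  split_ifs
  · rw [abs_of_pos (invMills_pos _)]
    exact invMills_le hM (abs_le.1 hy).1
  · rw [abs_neg, abs_of_pos (invMills_pos _)]
    exact invMills_le hM (by linarith [(abs_le.1 hy).2])
  · rw [abs_zero]; positivity

lemma strictAnti_score {x : ℤ} (hx : x = 1 ∨ x = -1) : StrictAnti (score x) := by
  intro y z hyz
  obtain rfl | rfl := hx
  · simpa only [score_one] using strictAnti_invMills hyz
  · simpa only [score_neg_one, neg_lt_neg_iff] using strictAnti_invMills (neg_lt_neg hyz)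

/-- Only `y` has to be bounded: by monotonicity `z` may be replaced by `y + b`, which stays in
`[-(M+1), M+1]` because `b ≤ 1`. This is why no a priori bound on the estimator is needed. -/
lemma minCurvature_mul_le_score_sub {M b y z : ℝ} {x : ℤ} (hx : x = 1 ∨ x = -1) (hb : 0 ≤ b)
    (hb1 : b ≤ 1) (hy : |y| ≤ M) (h : b ≤ z - y) :
    minCurvature M * b ≤ score x y - score x z := by
  have hM : 0 ≤ M := (abs_nonneg y).trans hy
  have hz := (strictAnti_score hx).antitone (by linarith : y + b ≤ z)
  have hy' := abs_le.1 hy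
  refine le_trans ?_ (sub_le_sub_left hz _)
  obtain rfl | rfl := hx
  · simp only [score_one]
    exact minCurvature_mul_le_sub hM hb hb1 (abs_le.2 ⟨by linarith, by linarith⟩)
      (abs_le.2 ⟨by linarith, by linarith⟩)
  · simp only [score_neg_one]
    have := minCurvature_mul_le_sub (y := -(y + b)) hM hb hb1 (abs_le.2 ⟨by linarith, by linarith⟩)
      (abs_le.2 ⟨by linarith, by linarith⟩)
    rw [show -(y + b) + b = -y by ring] at this
    linarith

lemma minCurvature_mul_le_score_sub' {M b y z : ℝ} {x : ℤ} (hx : x = 1 ∨ x = -1) (hb : 0 ≤ b)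
    (hb1 : b ≤ 1) (hy : |y| ≤ M) (h : b ≤ y - z) :
    minCurvature M * b ≤ score x z - score x y := by
  have hM : 0 ≤ M := (abs_nonneg y).trans hy
  have hz := (strictAnti_score hx).antitone (by linarith : z ≤ y - b)
  have hy' := abs_le.1 hy
  refine le_trans ?_ (sub_le_sub_right hz _)
  obtain rfl | rfl := hx
  · simp only [score_one]
    have := minCurvature_mul_le_sub (y := y - b) hM hb hb1 (abs_le.2 ⟨by linarith, by linarith⟩)
      (abs_le.2 ⟨by linarith, by linarith⟩)
    rwa [sub_add_cancel] at this
  · simp only [score_neg_one]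
    have := minCurvature_mul_le_sub (y := -y) hM hb hb1 (abs_le.2 ⟨by linarith, by linarith⟩)
      (abs_le.2 ⟨by linarith, by linarith⟩)
    rw [show -(y - b) = -y + b by ring]
    linarith

lemma minCurvature_mul_le_sign_mul_score_sub {M b y z s : ℝ} {x : ℤ} (hx : x = 1 ∨ x = -1)
    (hs : s = 1 ∨ s = -1) (hb : 0 ≤ b) (hb1 : b ≤ 1) (hy : |y| ≤ M) (h : b ≤ s * (z - y)) :
    minCurvature M * b ≤ s * (score x y - score x z) := by
  obtain rfl | rfl := hs
  · rw [one_mul] at h ⊢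
    exact minCurvature_mul_le_score_sub hx hb hb1 hy h
  · have := minCurvature_mul_le_score_sub' hx hb hb1 hy (by linarith : b ≤ y - z)
    linarith

/-! ### Directional derivatives of the log-likelihood -/

section Deterministic

variable {T n : ℕ} (N : Pair n → ℕ) (X : Pair n → Fin T → ℤ)

/-- The derivative of the log-likelihood at `v` in the direction `w`. -/
def scoreForm (v w : Fin n → ℝ) : ℝ :=
  ∑ e : Pair n, ∑ t : Fin T, if (t : ℕ) < N e then score (X e t) (relScore v e) * relScore w e else 0

/-- The indicator vector of a finite set of subjects. -/
def indVec (S : Finset (Fin n)) : Fin n → ℝ := fun i => if i ∈ S then 1 else 0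

/-- The pairs with one member in `A` and one in `D` which are compared at least once. -/
def comparedPairs (A D : Finset (Fin n)) : Finset (Pair n) :=
  Finset.univ.filter fun e => 0 < N e ∧
    ((e.1.1 ∈ A ∧ e.1.2 ∈ D) ∨ (e.1.1 ∈ D ∧ e.1.2 ∈ A))

/-- The subjects at which `f` is at least `c`. -/
def superlevel (f : Fin n → ℝ) (c : ℝ) : Finset (Fin n) := Finset.univ.filter fun i => c ≤ f i

lemma mem_superlevel {f : Fin n → ℝ} {c : ℝ} {i : Fin n} : i ∈ superlevel f c ↔ c ≤ f i := by
  simp [superlevel]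

variable {N X}

lemma scoreForm_sum {ι : Type*} (s : Finset ι) (v : Fin n → ℝ) (w : ι → Fin n → ℝ) :
    scoreForm N X v (∑ k ∈ s, w k) = ∑ k ∈ s, scoreForm N X v (w k) := by
  unfold scoreForm
  rw [Finset.sum_comm (s := s)]
  refine Finset.sum_congr rfl fun e _ => ?_
  rw [Finset.sum_comm (s := s)]
  refine Finset.sum_congr rfl fun t _ => ?_
  split_ifs
  · rw [← Finset.mul_sum]
    congr 1
    simp [relScore, Finset.sum_apply, Finset.sum_sub_distrib]
  · simp

lemma indVec_eq_sum (S : Finset (Fin n)) : indVec S = ∑ i ∈ S, Pi.single i (1 : ℝ) := by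
  funext j
  simp [indVec, Finset.sum_apply, Pi.single_apply]

lemma abs_scoreForm_indVec_le {u : Fin n → ℝ} {z : ℝ}
    (hz : ∀ i, |scoreForm N X u (Pi.single i 1)| ≤ z) (S : Finset (Fin n)) :
    |scoreForm N X u (indVec S)| ≤ z * S.card := by
  rw [indVec_eq_sum, scoreForm_sum]
  refine (Finset.abs_sum_le_sum_abs _ _).trans ?_
  refine (Finset.sum_le_card_nsmul _ _ z fun i _ => hz i).trans_eq ?_
  rw [nsmul_eq_mul, mul_comm]

lemma relScore_add_smul (v w : Fin n → ℝ) (s : ℝ) (e : Pair n) :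
    relScore (v + s • w) e = relScore v e + s * relScore w e := by
  simp [relScore]; ring

lemma hasDerivAt_logLik (v w : Fin n → ℝ) :
    HasDerivAt (fun s : ℝ => logLik N X (v + s • w)) (scoreForm N X v w) 0 := by
  unfold logLik scoreForm
  refine HasDerivAt.fun_sum fun e _ => HasDerivAt.fun_sum fun t _ => ?_
  split_ifs
  · simp_rw [relScore_add_smul]
    have h1 : HasDerivAt (fun s : ℝ => relScore v e + s * relScore w e) (relScore w e) 0 := by
      simpa using ((hasDerivAt_id (0 : ℝ)).mul_const (relScore w e)).const_add (relScore v e)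
    have h2 : HasDerivAt (fun y => Real.log (tmMass (X e t) y)) (score (X e t) (relScore v e))
        (relScore v e + 0 * relScore w e) := by
      simpa using hasDerivAt_log_tmMass (X e t) (relScore v e)
    exact h2.comp (0 : ℝ) h1
  · exact hasDerivAt_const _ _

lemma logLik_nonpos (v : Fin n → ℝ) : logLik N X v ≤ 0 := by
  refine Finset.sum_nonpos fun e _ => Finset.sum_nonpos fun t _ => ?_
  split_ifs
  · exact log_tmMass_nonpos _ _
  · exact le_rfl

lemma continuous_logLik : Continuous (logLik N X) := by
  refine continuous_finsetSum _ fun e _ => continuous_finsetSum _ fun t _ => ?_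
  split_ifs
  · have h1 : Continuous fun y => Real.log (tmMass (X e t) y) :=
      continuous_iff_continuousAt.2 fun y => (hasDerivAt_log_tmMass (X e t) y).continuousAt
    have h2 : Continuous fun v : Fin n → ℝ => relScore v e := by
      unfold relScore; fun_prop
    exact h1.comp h2
  · exact continuous_const

lemma logLik_sub_const (v : Fin n → ℝ) (c : ℝ) :
    logLik N X (fun i => v i - c) = logLik N X v := by
  simp [logLik, relScore]

lemma scoreForm_eq_zero_of_forall_le {v : Fin n → ℝ} (hv : ∀ w, logLik N X w ≤ logLik N X v)
    (w : Fin n → ℝ) : scoreForm N X v w = 0 := by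
  refine IsLocalMax.hasDerivAt_eq_zero (Eventually.of_forall fun s => ?_) (hasDerivAt_logLik v w)
  simpa using hv _

/-- The likelihood is invariant under common shifts, so the normalisation costs nothing and all
directional derivatives vanish at an MLE. -/
lemma IsMLE.forall_le {v : Fin n → ℝ} (hv : IsMLE N X v) (w : Fin n → ℝ) :
    logLik N X w ≤ logLik N X v := by
  obtain hn | hn := Nat.eq_zero_or_pos n
  · subst hn
    exact (congrArg _ (Subsingleton.elim w v)).le
  · rw [← logLik_sub_const w (w ⟨0, hn⟩)]
    refine hv.2 _ fun i hi => ?_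
    rw [show i = ⟨0, hn⟩ from Fin.ext hi, sub_self]

lemma IsMLE.scoreForm_eq_zero {v : Fin n → ℝ} (hv : IsMLE N X v) (w : Fin n → ℝ) :
    scoreForm N X v w = 0 :=
  scoreForm_eq_zero_of_forall_le hv.forall_le w

/-! ### Monotonicity of the score along superlevel sets of the error -/

lemma scoreForm_sub_scoreForm (v v' w : Fin n → ℝ) :
    scoreForm N X v w - scoreForm N X v' w =
      ∑ e : Pair n, ∑ t : Fin T, if (t : ℕ) < N e then
        (score (X e t) (relScore v e) - score (X e t) (relScore v' e)) * relScore w e else 0 := by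
  unfold scoreForm
  simp_rw [← Finset.sum_sub_distrib]
  refine Finset.sum_congr rfl fun e _ => Finset.sum_congr rfl fun t _ => ?_
  split_ifs <;> ring

lemma relScore_indVec (S : Finset (Fin n)) (e : Pair n) :
    relScore (indVec S) e = (if e.1.1 ∈ S then 1 else 0) - (if e.1.2 ∈ S then 1 else 0) := rfl

/-- A pair crossing the boundary of the superlevel set has its relative error directed inwards, so
monotonicity of the score gives every term the same sign. Pairs that also skip the layer of width
`b` have a gap of at least `b`, and one observed comparison of such a pair already contributes
`minCurvature M * b`. The sign `σ` treats over- and underestimation together. -/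
lemma minCurvature_mul_card_comparedPairs_le {f u v : Fin n → ℝ} {M c b σ : ℝ} (hT : 1 ≤ T)
    (hX : ∀ e t, X e t = 1 ∨ X e t = -1) (hM : ∀ e : Pair n, |relScore u e| ≤ M)
    (hσ : σ = 1 ∨ σ = -1) (hf : ∀ i, f i = σ * (v i - u i)) (hb : 0 ≤ b) (hb1 : b ≤ 1) :
    minCurvature M * b * (comparedPairs N (superlevel f c) (superlevel f (c - b))ᶜ).card ≤
      σ * (scoreForm N X u (indVec (superlevel f c)) -
        scoreForm N X v (indVec (superlevel f c))) := by
  rw [scoreForm_sub_scoreForm, comparedPairs, Finset.card_filter, Nat.cast_sum, Finset.mul_sum,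
    Finset.mul_sum]
  have hgap : ∀ e t (s a : ℝ), s = 1 ∨ s = -1 → 0 ≤ a → a ≤ 1 → a ≤ s * relScore f e →
      minCurvature M * a ≤
        (score (X e t) (relScore u e) - score (X e t) (relScore v e)) * (σ * s) := by
    intro e t s a hs ha ha1 has
    rw [mul_comm _ (σ * s)]
    refine minCurvature_mul_le_sign_mul_score_sub (hX e t) ?_ ha ha1 (hM e) ?_
    · obtain rfl | rfl := hσ <;> obtain rfl | rfl := hs <;> simp
    · refine has.trans_eq ?_
      simp only [relScore, hf]; ring
  have hterm : ∀ e t, 0 ≤ (score (X e t) (relScore u e) - score (X e t) (relScore v e)) *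
      (σ * relScore (indVec (superlevel f c)) e) := by
    intro e t
    have hp := hgap e t 1 0 (Or.inl rfl) le_rfl zero_le_one
    have hm := hgap e t (-1) 0 (Or.inr rfl) le_rfl zero_le_one
    rw [mul_zero] at hp hm
    rw [relScore_indVec]
    by_cases h1 : e.1.1 ∈ superlevel f c <;> by_cases h2 : e.1.2 ∈ superlevel f c
    · simp [h1, h2]
    · simp only [h1, h2, if_true, if_false, sub_zero]
      apply hp
      rw [mem_superlevel] at h1 h2
      simp only [relScore]; linarith
    · simp only [h1, h2, if_true, if_false, zero_sub]
      apply hm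
      rw [mem_superlevel] at h1 h2
      simp only [relScore]; linarith
    · simp [h1, h2]
  refine Finset.sum_le_sum fun e _ => ?_
  have hinner : σ * (∑ t : Fin T, if (t : ℕ) < N e then
        (score (X e t) (relScore u e) - score (X e t) (relScore v e)) *
          relScore (indVec (superlevel f c)) e else 0) =
      ∑ t : Fin T, if (t : ℕ) < N e then
        (score (X e t) (relScore u e) - score (X e t) (relScore v e)) *
          (σ * relScore (indVec (superlevel f c)) e) else 0 := by
    rw [Finset.mul_sum]
    refine Finset.sum_congr rfl fun t _ => ?_
    split_ifs <;> ring
  have hnn : ∀ t : Fin T, 0 ≤ if (t : ℕ) < N e then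
        (score (X e t) (relScore u e) - score (X e t) (relScore v e)) *
          (σ * relScore (indVec (superlevel f c)) e) else 0 := by
    intro t
    split_ifs
    · exact hterm e t
    · exact le_rfl
  rw [hinner]
  by_cases he : 0 < N e ∧ ((e.1.1 ∈ superlevel f c ∧ e.1.2 ∈ (superlevel f (c - b))ᶜ) ∨
      (e.1.1 ∈ (superlevel f (c - b))ᶜ ∧ e.1.2 ∈ superlevel f c))
  · rw [if_pos he]
    -- Only the comparison `t = 0` is kept; it is observed because `0 < N e`.
    refine le_trans ?_ (Finset.single_le_sum (fun t _ => hnn t)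
      (Finset.mem_univ (⟨0, hT⟩ : Fin T)))
    rw [if_pos (by exact he.1), relScore_indVec, Nat.cast_one, mul_one]
    simp only [Finset.mem_compl, mem_superlevel, not_le] at he ⊢
    obtain ⟨-, ⟨h1, h2⟩ | ⟨h2, h1⟩⟩ := he
    · rw [if_pos h1, if_neg (by linarith), sub_zero]
      refine hgap e _ 1 b (Or.inl rfl) hb hb1 ?_
      simp only [relScore]; linarith
    · rw [if_pos h1, if_neg (by linarith), zero_sub]
      refine hgap e _ (-1) b (Or.inr rfl) hb hb1 ?_
      simp only [relScore]; linarith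
  · rw [if_neg he, Nat.cast_zero, mul_zero]
    exact Finset.sum_nonneg fun t _ => hnn t

end Deterministic

/-! ### Deterministic error bounds under vertex expansion -/

section Expansion

variable {T n : ℕ} {N : Pair n → ℕ} {X : Pair n → Fin T → ℤ}

variable (N) in
/-- Every set `A` of subjects has at least `L * #A` compared pairs leaving a set `A' ⊇ A`, as long
as `A'` has at most `n / 2` and at most `G * #A` elements. -/
def HasExpansion (G L : ℝ) : Prop :=
  ∀ A A' : Finset (Fin n), A.Nonempty → A ⊆ A' → 2 * A'.card ≤ n → (A'.card : ℝ) ≤ G * A.card →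
    L * A.card ≤ (comparedPairs N A A'ᶜ).card

lemma superlevel_subset {f : Fin n → ℝ} {c d : ℝ} (h : d ≤ c) :
    superlevel f c ⊆ superlevel f d := fun _ hi =>
  mem_superlevel.2 (h.trans (mem_superlevel.1 hi))

/-- If lowering the level by `b` enlarged the set neither beyond half of the subjects nor by the
factor `G`, expansion would produce at least `L * #A` skipping pairs, contradicting `hf` and `z < a
* L`. -/
lemma pow_le_card_superlevel {f : Fin n → ℝ} {G L a b z : ℝ} (hG : 0 ≤ G) (hexp : HasExpansion N G L)
    (hb : 0 ≤ b) (ha : 0 ≤ a) (hz : z < a * L)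
    (hf : ∀ c, a * (comparedPairs N (superlevel f c) (superlevel f (c - b))ᶜ).card ≤
      z * (superlevel f c).card) (i : Fin n) (j : ℕ) :
    n < 2 * (superlevel f (f i - j * b)).card ∨
      G ^ j ≤ (superlevel f (f i - j * b)).card := by
  have hne : ∀ j : ℕ, (superlevel f (f i - j * b)).Nonempty := fun j =>
    ⟨i, mem_superlevel.2 (by nlinarith [mul_nonneg (Nat.cast_nonneg (α := ℝ) j) hb])⟩
  induction j with
  | zero =>
    right
    rw [pow_zero]
    exact_mod_cast (hne 0).card_pos
  | succ j ih =>
    by_contra! h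
    obtain ⟨h1, h2⟩ := h
    have hs : f i - (j + 1 : ℕ) * b = f i - j * b - b := by push_cast; ring
    have hsub : superlevel f (f i - j * b) ⊆ superlevel f (f i - (j + 1 : ℕ) * b) :=
      superlevel_subset (by rw [hs]; linarith)
    have hcard := Finset.card_le_card hsub
    have ih' : G ^ j ≤ (superlevel f (f i - j * b)).card := ih.resolve_left (by omega)
    have h3 := hexp _ _ (hne j) hsub h1 (h2.le.trans (by
      rw [pow_succ, mul_comm]; exact mul_le_mul_of_nonneg_left ih' hG))
    have h4 := hf (f i - j * b)
    rw [← hs] at h4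
    have hpos : (0 : ℝ) < (superlevel f (f i - j * b)).card := by exact_mod_cast (hne j).card_pos
    nlinarith [mul_le_mul_of_nonneg_left h3 ha, mul_lt_mul_of_pos_right hz hpos]

lemma lt_two_mul_card_superlevel {f : Fin n → ℝ} {G L a b z : ℝ} {k : ℕ} (hG : 0 ≤ G)
    (hexp : HasExpansion N G L) (hk : n < 2 * G ^ k) (hb : 0 ≤ b) (ha : 0 ≤ a) (hz : z < a * L)
    (hf : ∀ c, a * (comparedPairs N (superlevel f c) (superlevel f (c - b))ᶜ).card ≤
      z * (superlevel f c).card) (i : Fin n) :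
    n < 2 * (superlevel f (f i - k * b)).card := by
  obtain h | h := pow_le_card_superlevel hG hexp hb ha hz hf i k
  · exact h
  · have : (n : ℝ) < 2 * (superlevel f (f i - k * b)).card := by linarith
    exact_mod_cast this

variable {u v : Fin n → ℝ} {M G L b z : ℝ} {k : ℕ}

/-- If the score at `v` does not point into any superlevel set of the error `v - u` or of its
negative, then the oscillation of the error is at most `2 * k * b`. -/
lemma error_sub_error_le (hT : 1 ≤ T) (hX : ∀ e t, X e t = 1 ∨ X e t = -1)
    (hM : ∀ e : Pair n, |relScore u e| ≤ M) (hG : 0 ≤ G) (hexp : HasExpansion N G L)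
    (hk : n < 2 * G ^ k) (hb : 0 ≤ b) (hb1 : b ≤ 1)
    (hu : ∀ i, |scoreForm N X u (Pi.single i 1)| ≤ z) (hz : z < minCurvature M * b * L)
    (hv : ∀ σ c : ℝ, σ = 1 ∨ σ = -1 →
      0 ≤ σ * scoreForm N X v (indVec (superlevel (fun i => σ * (v i - u i)) c)))
    (i j : Fin n) : (v i - u i) - (v j - u j) ≤ 2 * k * b := by
  have key : ∀ σ : ℝ, σ = 1 ∨ σ = -1 → ∀ i : Fin n,
      n < 2 * (superlevel (fun i => σ * (v i - u i)) (σ * (v i - u i) - k * b)).card := by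
    intro σ hσ i
    refine lt_two_mul_card_superlevel (f := fun i => σ * (v i - u i)) hG hexp hk hb
      (mul_nonneg (minCurvature_pos M).le hb) hz (fun c => ?_) i
    refine (minCurvature_mul_card_comparedPairs_le (v := v) hT hX hM hσ (fun _ => rfl) hb hb1).trans
      ?_
    have h1 := hv σ c hσ
    have h2 := abs_scoreForm_indVec_le hu (superlevel (fun i => σ * (v i - u i)) c)
    refine le_trans ?_ h2
    rw [mul_sub]
    have h3 : |σ| = 1 := by obtain rfl | rfl := hσ <;> simp
    have h4 := le_abs_self (σ * scoreForm N X u (indVec (superlevel (fun i => σ * (v i - u i)) c)))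
    rw [abs_mul, h3, one_mul] at h4
    linarith
  have h1 := key 1 (Or.inl rfl) i
  have h2 := key (-1) (Or.inr rfl) j
  obtain ⟨l, hl⟩ : (superlevel (fun i => 1 * (v i - u i)) (1 * (v i - u i) - k * b) ∩
      superlevel (fun i => -1 * (v i - u i)) (-1 * (v j - u j) - k * b)).Nonempty := by
    -- Two majorities share a subject `l`, whose error is at least that of `i` minus `k b` and at
    -- most that of `j` plus `k b`.
    apply Finset.inter_nonempty_of_card_lt_card_add_card (s := Finset.univ)
      (Finset.subset_univ _) (Finset.subset_univ _)
    rw [Finset.card_univ, Fintype.card_fin]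
    omega
  rw [Finset.mem_inter, mem_superlevel, mem_superlevel] at hl
  linarith [hl.1, hl.2]

/-- The other MLE `w` plays the role of the true scores: its score vanishes, so `z = 0` is allowed
and every `b > 0` works. Any finite bound `M` on its relative scores suffices. -/
lemma IsMLE.eq_of_hasExpansion {v w : Fin n → ℝ} (hT : 1 ≤ T)
    (hX : ∀ e t, X e t = 1 ∨ X e t = -1) (hG : 0 ≤ G) (hexp : HasExpansion N G L) (hL : 0 < L)
    (hk : n < 2 * G ^ k) (hv : IsMLE N X v) (hw : IsMLE N X w) : v = w := by
  obtain hn | hn := Nat.eq_zero_or_pos n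
  · subst hn; exact Subsingleton.elim _ _
  have hle : ∀ i j, (v i - w i) - (v j - w j) ≤ 0 := by
    intro i j
    obtain ⟨M, hM⟩ : ∃ M, ∀ e : Pair n, |relScore w e| ≤ M :=
      ⟨∑ e : Pair n, |relScore w e|, fun e =>
        Finset.single_le_sum (f := fun e => |relScore w e|) (fun _ _ => abs_nonneg _)
          (Finset.mem_univ e)⟩
    have h : ∀ b : ℝ, 0 < b → b ≤ 1 → (v i - w i) - (v j - w j) ≤ 2 * k * b := by
      intro b hb hb1
      refine error_sub_error_le (z := 0) hT hX hM hG hexp hk hb.le hb1 (fun i => ?_)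
        (mul_pos (mul_pos (minCurvature_pos M) hb) hL) (fun σ c _ => ?_) i j
      · rw [hw.scoreForm_eq_zero, abs_zero]
      · rw [hv.scoreForm_eq_zero, mul_zero]
    by_contra! hpos
    set d := (v i - w i) - (v j - w j) with hd
    have hk0 : (0 : ℝ) ≤ k := Nat.cast_nonneg k
    have h5 := h (min 1 (d / (4 * k + 4))) (by positivity) (min_le_left _ _)
    have h6 : 2 * k * min 1 (d / (4 * k + 4)) ≤ 2 * k * (d / (4 * k + 4)) :=
      mul_le_mul_of_nonneg_left (min_le_right _ _) (by positivity)
    have h7 : 2 * k * (d / (4 * k + 4)) < d := by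
      rw [mul_div_assoc', div_lt_iff₀ (by positivity)]
      nlinarith
    linarith
  funext i
  have h0 := hv.1 ⟨0, hn⟩ rfl
  have h0' := hw.1 ⟨0, hn⟩ rfl
  linarith [hle i ⟨0, hn⟩, hle ⟨0, hn⟩ i]

/-! ### Existence of the MLE via a vanishing quadratic penalty -/

lemma exists_penalized_max (u : Fin n → ℝ) {ε : ℝ} (hε : 0 < ε) :
    ∃ v, ∀ w, logLik N X w - ε * ∑ i, (w i - u i) ^ 2 ≤
      logLik N X v - ε * ∑ i, (v i - u i) ^ 2 := by
  set F : (Fin n → ℝ) → ℝ := fun w => logLik N X w - ε * ∑ i, (w i - u i) ^ 2 with hF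
  set R := Real.sqrt (-logLik N X u / ε) with hR
  have hcont : Continuous F := continuous_logLik.sub (by fun_prop)
  obtain ⟨v, -, hv⟩ := (isCompact_closedBall u R).exists_isMaxOn
    ⟨u, Metric.mem_closedBall_self (Real.sqrt_nonneg _)⟩ hcont.continuousOn
  refine ⟨v, fun w => ?_⟩
  by_cases hw : w ∈ Metric.closedBall u R
  · exact hv hw
  · have h1 : F u ≤ F v := hv (Metric.mem_closedBall_self (Real.sqrt_nonneg _))
    -- Outside the ball the penalty is at least `-logLik N X u`, and the likelihood is nonpositive,
    -- so the penalised value does not exceed the one at `u`.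
    refine le_trans ?_ h1
    rw [Metric.mem_closedBall, dist_eq_norm, pi_norm_le_iff_of_nonneg (Real.sqrt_nonneg _)] at hw
    push Not at hw
    obtain ⟨i, hi⟩ := hw
    have h2 : -logLik N X u / ε ≤ (w i - u i) ^ 2 := by
      rw [Pi.sub_apply, Real.norm_eq_abs] at hi
      have := (Real.sqrt_le_left (abs_nonneg _)).1 hi.le
      rwa [sq_abs] at this
    have h3 : (w i - u i) ^ 2 ≤ ∑ i, (w i - u i) ^ 2 :=
      Finset.single_le_sum (f := fun i => (w i - u i) ^ 2) (fun _ _ => sq_nonneg _)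
        (Finset.mem_univ i)
    rw [div_le_iff₀ hε] at h2
    have h4 : logLik N X w ≤ 0 := logLik_nonpos w
    have h5 : F u = logLik N X u := by simp [hF]
    rw [h5]
    nlinarith

lemma scoreForm_eq_of_penalized_max {ε : ℝ}
    (hv : ∀ w, logLik N X w - ε * ∑ i, (w i - u i) ^ 2 ≤
      logLik N X v - ε * ∑ i, (v i - u i) ^ 2) (w : Fin n → ℝ) :
    scoreForm N X v w = 2 * ε * ∑ i, (v i - u i) * w i := by
  have h1 : HasDerivAt (fun s : ℝ => ∑ i, ((v + s • w) i - u i) ^ 2)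
      (∑ i, 2 * ((v i - u i) * w i)) 0 := by
    refine HasDerivAt.fun_sum fun i _ => ?_
    have h2 : HasDerivAt (fun s : ℝ => (v + s • w) i - u i) (w i) 0 := by
      have := (((hasDerivAt_id (0 : ℝ)).mul_const (w i)).const_add (v i)).sub_const (u i)
      simpa using this
    have := h2.pow 2
    convert! this using 1
    simp; ring
  have h3 := (hasDerivAt_logLik (N := N) (X := X) v w).sub (h1.const_mul ε)
  have h4 := IsLocalMax.hasDerivAt_eq_zero (Eventually.of_forall fun s => ?_) h3
  · rw [← Finset.mul_sum] at h4
    linarith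
  · simpa using hv (v + s • w)

lemma sum_indVec_mul (S : Finset (Fin n)) (g : Fin n → ℝ) :
    ∑ i, g i * indVec S i = ∑ i ∈ S, g i := by
  simp [indVec]

/-- The sum of a mean zero vector over one of its superlevel sets is nonnegative. -/
lemma sum_superlevel_nonneg {f : Fin n → ℝ} (hf : ∑ i, f i = 0) (c : ℝ) :
    0 ≤ ∑ i ∈ superlevel f c, f i := by
  obtain hc | hc := le_total 0 c
  · exact Finset.sum_nonneg fun i hi => hc.trans (mem_superlevel.1 hi)
  · rw [← Finset.sum_add_sum_compl (superlevel f c)] at hf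
    have : ∑ i ∈ (superlevel f c)ᶜ, f i ≤ 0 := Finset.sum_nonpos fun i hi => by
      rw [Finset.mem_compl, mem_superlevel, not_le] at hi
      linarith
    linarith

/-- Penalised maximisers lie in a ball around `u` whose radius does not depend on `ε`. Their error
has mean zero by shift invariance, so their score along each superlevel set has the sign required by
`error_sub_error_le`. A maximiser of the likelihood over this ball is then global, letting `ε` tend
to `0`. -/
lemma exists_isMLE (hn : 0 < n) (hT : 1 ≤ T) (hX : ∀ e t, X e t = 1 ∨ X e t = -1)
    (hM : ∀ e : Pair n, |relScore u e| ≤ M) (hG : 0 ≤ G) (hexp : HasExpansion N G L)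
    (hk : n < 2 * G ^ k) (hb : 0 ≤ b) (hb1 : b ≤ 1)
    (hu : ∀ i, |scoreForm N X u (Pi.single i 1)| ≤ z) (hz : z < minCurvature M * b * L) :
    ∃ v, IsMLE N X v := by
  have hr : (0 : ℝ) ≤ 2 * k * b := by positivity
  obtain ⟨v, -, hv⟩ := (isCompact_closedBall u (2 * k * b)).exists_isMaxOn
    ⟨u, Metric.mem_closedBall_self hr⟩ (continuous_logLik (N := N) (X := X)).continuousOn
  have hpen : ∀ ε : ℝ, 0 < ε → ∀ w, logLik N X w - ε * ∑ i, (w i - u i) ^ 2 ≤ logLik N X v := by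
    intro ε hε w
    obtain ⟨x, hx⟩ := exists_penalized_max (N := N) (X := X) u hε
    have hs := scoreForm_eq_of_penalized_max hx
    have hsum : ∑ i, (x i - u i) = 0 := by
      have h1 := hs (indVec Finset.univ)
      rw [sum_indVec_mul] at h1
      have h2 : scoreForm N X x (indVec Finset.univ) = 0 := by
        simp [scoreForm, relScore_indVec]
      rw [h2] at h1
      simpa [hε.ne'] using h1.symm
    have hosc := error_sub_error_le hT hX hM hG hexp hk hb hb1 hu hz (v := x) (fun σ c hσ => by
      rw [hs, sum_indVec_mul, mul_left_comm, Finset.mul_sum]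
      have h3 := sum_superlevel_nonneg (f := fun i => σ * (x i - u i))
        (by rw [← Finset.mul_sum, hsum, mul_zero]) c
      positivity)
    have hball : x ∈ Metric.closedBall u (2 * k * b) := by
      rw [Metric.mem_closedBall, dist_eq_norm, pi_norm_le_iff_of_nonneg hr]
      intro i
      have : Nonempty (Fin n) := ⟨⟨0, hn⟩⟩
      obtain ⟨j, hj⟩ := Finset.exists_le_of_sum_le (s := Finset.univ)
        (f := fun i => x i - u i) (g := fun _ => (0 : ℝ)) Finset.univ_nonempty (by simp [hsum])
      obtain ⟨l, hl⟩ := Finset.exists_le_of_sum_le (s := Finset.univ)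
        (g := fun i => x i - u i) (f := fun _ => (0 : ℝ)) Finset.univ_nonempty (by simp [hsum])
      rw [Pi.sub_apply, Real.norm_eq_abs, abs_le]
      constructor <;> linarith [hosc i j, hosc l i, hj.2, hl.2]
    have h4 : logLik N X x ≤ logLik N X v := hv hball
    have h5 : 0 ≤ ε * ∑ i, (x i - u i) ^ 2 :=
      mul_nonneg hε.le (Finset.sum_nonneg fun _ _ => sq_nonneg _)
    linarith [hx w]
  have hmax : ∀ w, logLik N X w ≤ logLik N X v := by
    intro w
    have h0 : Tendsto (fun ε : ℝ => logLik N X w - ε * ∑ i, (w i - u i) ^ 2) (𝓝[>] 0)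
        (𝓝 (logLik N X w - 0 * ∑ i, (w i - u i) ^ 2)) :=
      (Continuous.tendsto (by fun_prop) 0).mono_left nhdsWithin_le_nhds
    rw [zero_mul, sub_zero] at h0
    exact le_of_tendsto h0 (eventually_nhdsWithin_of_forall fun ε hε => hpen ε hε w)
  refine ⟨fun i => v i - v ⟨0, hn⟩, fun i hi => ?_, fun w _ => ?_⟩
  · simp [show i = ⟨0, hn⟩ from Fin.ext hi]
  · rw [logLik_sub_const]; exact hmax w

theorem mleUniqueWithin_of_hasExpansion (hn : 0 < n) (hT : 1 ≤ T)
    (hX : ∀ e t, X e t = 1 ∨ X e t = -1) (hu0 : FirstZero u)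
    (hM : ∀ e : Pair n, |relScore u e| ≤ M) (hG : 0 ≤ G) (hexp : HasExpansion N G L) (hL : 0 < L)
    (hk : n < 2 * G ^ k) (hb : 0 ≤ b) (hb1 : b ≤ 1)
    (hu : ∀ i, |scoreForm N X u (Pi.single i 1)| ≤ z) (hz : z < minCurvature M * b * L) :
    MLEUniqueWithin N X u (2 * k * b) := by
  obtain ⟨v, hv⟩ := exists_isMLE hn hT hX hM hG hexp hk hb hb1 hu hz
  refine ⟨⟨v, hv, fun w hw => hw.eq_of_hasExpansion hT hX hG hexp hL hk hv⟩, fun v hv => ?_⟩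
  have hosc := error_sub_error_le hT hX hM hG hexp hk hb hb1 hu hz (v := v) (fun σ c hσ => by
    rw [hv.scoreForm_eq_zero, mul_zero])
  rw [pi_norm_le_iff_of_nonneg (by positivity)]
  intro i
  have h1 := hv.1 ⟨0, hn⟩ rfl
  have h2 := hu0 ⟨0, hn⟩ rfl
  rw [Pi.sub_apply, Real.norm_eq_abs, abs_le]
  constructor <;> linarith [hosc i ⟨0, hn⟩, hosc ⟨0, hn⟩ i]

end Expansion

set_option linter.unusedSectionVars false

/-! ### Independence of blocks of an independent family -/

/-- The rows of an independent family of random variables indexed by pairs are independent. -/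
lemma iIndepFun_curry {Ω ι κ : Type*} [MeasurableSpace Ω] {μ : Measure Ω} [IsProbabilityMeasure μ]
    [Countable ι] [Countable κ] {𝓧 : ι → κ → Type*} [∀ i j, MeasurableSpace (𝓧 i j)]
    {X : (i : ι) → (j : κ) → Ω → 𝓧 i j} (hm : ∀ i j, AEMeasurable (X i j) μ)
    (h : iIndepFun (fun (q : (_ : ι) × κ) ω => X q.1 q.2 ω) μ) :
    iIndepFun (fun i ω j => X i j ω) μ := by
  have hprob : ∀ i j, IsProbabilityMeasure (μ.map (X i j)) :=
    fun i j => Measure.isProbabilityMeasure_map (hm i j)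
  have hrow : ∀ i, AEMeasurable (fun ω j => X i j ω) μ := fun i => aemeasurable_pi_iff.2 (hm i)
  -- Independence means that the joint law is a product; a product over pairs of indices curries to
  -- a product of products.
  rw [iIndepFun_iff_map_fun_eq_infinitePi_map₀' hrow]
  have h1 := h.map_fun_eq_infinitePi_map₀' (fun q => hm q.1 q.2)
  have h2 : ∀ i, μ.map (fun ω j => X i j ω) = Measure.infinitePi fun j => μ.map (X i j) := by
    intro i
    have hi : iIndepFun (fun j ω => X i j ω) μ :=
      h.precomp (g := fun j : κ => (⟨i, j⟩ : (_ : ι) × κ)) (fun a b hab => by simpa using hab)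
    exact hi.map_fun_eq_infinitePi_map₀' (hm i)
  simp_rw [h2]
  rw [← Measure.infinitePi_map_piCurry (fun i j => μ.map (X i j)), ← h1,
    AEMeasurable.map_map_of_aemeasurable (MeasurableEquiv.measurable _).aemeasurable
      (aemeasurable_pi_iff.2 fun q => hm q.1 q.2)]
  rfl

/-! ### Laws of the counts and outcomes -/

section Laws

variable {Ω : Type*} [MeasurableSpace Ω] {μ : Measure Ω} [IsProbabilityMeasure μ]

lemma ae_tmLaw (y : ℝ) : ∀ᵐ x ∂tmLaw y, x = 1 ∨ x = -1 := by
  unfold tmLaw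
  rw [ae_add_measure_iff]
  constructor <;> refine Measure.ae_smul_measure ?_ _ <;> rw [ae_dirac_iff .of_discrete] <;> simp

lemma integral_tmLaw (y : ℝ) (F : ℤ → ℝ) :
    ∫ x, F x ∂tmLaw y = probit y * F 1 + probit (-y) * F (-1) := by
  unfold tmLaw
  rw [integral_add_measure, integral_smul_measure, integral_smul_measure, integral_dirac,
    integral_dirac, tmMass_one, tmMass_neg_one, ENNReal.toReal_ofReal (probit_nonneg _),
    ENNReal.toReal_ofReal (probit_nonneg _), smul_eq_mul, smul_eq_mul]
  · exact (integrable_dirac (by simp)).smul_measure (by simp)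
  · exact (integrable_dirac (by simp)).smul_measure (by simp)

/-- A two-point exponential moment bound for the mean zero score. -/
lemma integral_exp_mul_score_sub_one_le {M y s : ℝ} (hy : |y| ≤ M)
    (hs : |s| * Real.exp (M + 1 / 2) ≤ 1) :
    ∫ x, (Real.exp (s * score x y) - 1) ∂tmLaw y ≤ (s * Real.exp (M + 1 / 2)) ^ 2 := by
  rw [integral_tmLaw]
  have hx : ∀ x : ℤ, Real.exp (s * score x y) - 1 ≤
      s * score x y + (s * Real.exp (M + 1 / 2)) ^ 2 := by
    intro x
    have h1 := abs_score_le x hy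
    have h2 : |s * score x y| ≤ |s| * Real.exp (M + 1 / 2) := by
      rw [abs_mul]; gcongr
    have h3 := (abs_le.1 (Real.abs_exp_sub_one_sub_id_le (h2.trans hs))).2
    have h4 : (s * score x y) ^ 2 ≤ (s * Real.exp (M + 1 / 2)) ^ 2 := by
      rw [sq_le_sq, abs_mul s (Real.exp _), abs_of_pos (Real.exp_pos _)]
      exact h2
    linarith
  -- The score has mean zero: both outcomes contribute `φ(y)`, with opposite signs.
  have h5 : probit y * score 1 y + probit (-y) * score (-1) y = 0 := by
    rw [score_one, score_neg_one, invMills, invMills, mul_neg,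
      mul_div_cancel₀ _ (probit_pos _).ne', mul_div_cancel₀ _ (probit_pos _).ne',
      normalDensity_neg, add_neg_cancel]
  have h6 : probit y + probit (-y) = 1 := by rw [probit_neg]; ring
  calc _ ≤ probit y * (s * score 1 y + (s * Real.exp (M + 1 / 2)) ^ 2) +
        probit (-y) * (s * score (-1) y + (s * Real.exp (M + 1 / 2)) ^ 2) := by
        gcongr
        · exact probit_nonneg _
        · exact hx 1
        · exact probit_nonneg _
        · exact hx (-1)
    _ = s * (probit y * score 1 y + probit (-y) * score (-1) y) +
        (probit y + probit (-y)) * (s * Real.exp (M + 1 / 2)) ^ 2 := by ring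
    _ = _ := by rw [h5, h6]; ring

variable {T : ℕ} {p : unitInterval} {K : Ω → ℕ}

lemma measureReal_pos_of_hasLaw_binomial (hK : HasLaw K (binomial T p) μ) :
    μ.real {ω | 0 < K ω} = 1 - (1 - (p : ℝ)) ^ T := by
  rw [hK.measureReal_eq (p := fun k => 0 < k) .of_discrete, ← binomial_real_zero T p,
    ← probReal_compl_eq_one_sub .of_discrete]
  congr 1
  ext k
  simp [Nat.pos_iff_ne_zero]

lemma le_measureReal_pos_of_hasLaw_binomial (hT : 1 ≤ T) (hK : HasLaw K (binomial T p) μ) :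
    (p : ℝ) ≤ μ.real {ω | 0 < K ω} := by
  rw [measureReal_pos_of_hasLaw_binomial hK]
  have := pow_le_of_le_one (sub_nonneg.2 p.2.2) (by linarith [p.2.1] : 1 - (p : ℝ) ≤ 1)
    (by omega : T ≠ 0)
  linarith

lemma measureReal_pos_le_of_hasLaw_binomial (hK : HasLaw K (binomial T p) μ) :
    μ.real {ω | 0 < K ω} ≤ T * p := by
  rw [measureReal_pos_of_hasLaw_binomial hK]
  have := one_add_mul_le_pow (a := -(p : ℝ)) (by linarith [p.2.2]) T
  rw [← sub_eq_add_neg] at this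
  linarith

lemma aemeasurable_ite_lt (hK : HasLaw K (binomial T p) μ) (t : ℕ) :
    AEMeasurable (fun ω => if t < K ω then (1 : ℝ) else 0) μ :=
  (Measurable.of_discrete (f := fun k : ℕ => if t < k then (1 : ℝ) else 0)).comp_aemeasurable
    hK.aemeasurable

lemma integral_ite_lt (hK : HasLaw K (binomial T p) μ) (t : ℕ) :
    ∫ ω, (if t < K ω then (1 : ℝ) else 0) ∂μ = μ.real {ω | t < K ω} := by
  have h1 := hK.integral_comp (f := fun k => if t < k then (1 : ℝ) else 0)
    Measurable.of_discrete.aestronglyMeasurable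
  have h2 := integral_indicator_one (μ := binomial T p)
    (.of_discrete : MeasurableSet {k : ℕ | t < k})
  rw [hK.measureReal_eq (p := fun k => t < k) .of_discrete, ← h2]
  refine h1.trans (integral_congr_ae (ae_of_all _ fun k => ?_))
  by_cases h : t < k <;> simp [Set.indicator, h]

lemma integral_ite_lt_le (hK : HasLaw K (binomial T p) μ) (t : ℕ) :
    ∫ ω, (if t < K ω then (1 : ℝ) else 0) ∂μ ≤ T * p := by
  rw [integral_ite_lt hK]
  refine le_trans (measureReal_mono fun ω (hω : t < K ω) => ?_)
    (measureReal_pos_le_of_hasLaw_binomial hK)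
  exact (Nat.zero_le t).trans_lt hω

/-- The exponential equals `1 - (1 - 1/e) * 1_{K > 0}` with `1 - 1/e ≥ 1/2`, and `P(K > 0) ≥ p`. -/
lemma mgf_ite_pos_neg_one_le (hT : 1 ≤ T) (hK : HasLaw K (binomial T p) μ) :
    mgf (fun ω => if 0 < K ω then (1 : ℝ) else 0) μ (-1) ≤ Real.exp (-(p : ℝ) / 2) := by
  have h1 := integral_ite_lt hK 0
  have h2 : mgf (fun ω => if 0 < K ω then (1 : ℝ) else 0) μ (-1) =
      ∫ ω, (1 - (1 - Real.exp (-1)) * (if 0 < K ω then (1 : ℝ) else 0)) ∂μ := by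
    unfold mgf
    refine integral_congr_ae (ae_of_all _ fun ω => ?_)
    by_cases h : 0 < K ω <;> simp [h]
  have hint : Integrable (fun ω => if 0 < K ω then (1 : ℝ) else 0) μ :=
    Integrable.of_bound (aemeasurable_ite_lt hK 0).aestronglyMeasurable 1
      (ae_of_all _ fun ω => by split_ifs <;> simp)
  rw [h2, integral_sub (integrable_const _) (hint.const_mul _), integral_const_mul, h1]
  simp only [integral_const, probReal_univ, smul_eq_mul, mul_one]
  have h3 := le_measureReal_pos_of_hasLaw_binomial hT hK
  have h4 : Real.exp (-1) ≤ 1 / 2 := by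
    rw [Real.exp_neg, inv_le_comm₀ (Real.exp_pos _) (by norm_num)]
    have := Real.add_one_le_exp (1 : ℝ)
    linarith
  have h5 := Real.add_one_le_exp (-(p : ℝ) / 2)
  nlinarith [p.2.1]

end Laws

/-! ### Concentration for comparison data -/

section Concentration

variable {Ω : Type*} [MeasurableSpace Ω] {μ : Measure Ω} [IsProbabilityMeasure μ] {T n : ℕ}
  {p : unitInterval} {u : Fin n → ℝ} {N : Pair n → Ω → ℕ} {X : Pair n → Fin T → Ω → ℤ}

lemma IsTMData.ae_outcome (h : IsTMData μ T p u N X) :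
    ∀ᵐ ω ∂μ, ∀ e t, X e t ω = 1 ∨ X e t ω = -1 := by
  rw [ae_all_iff]
  intro e
  rw [ae_all_iff]
  intro t
  exact ((h.law_outcome e t).ae_iff (p := fun x => x = 1 ∨ x = -1) .of_discrete).2 (ae_tmLaw _)

lemma IsTMData.aemeasurable (h : IsTMData μ T p u N X) (q : Pair n ⊕ (Pair n × Fin T)) :
    AEMeasurable (Sum.elim (fun e ω => (N e ω : ℤ)) (fun q ω => X q.1 q.2 ω) q) μ := by
  obtain e | q := q
  · exact Measurable.of_discrete.comp_aemeasurable (h.law_count e).aemeasurable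
  · exact (h.law_outcome q.1 q.2).aemeasurable

lemma IsTMData.iIndepFun_count (h : IsTMData μ T p u N X) :
    iIndepFun (fun e ω => (N e ω : ℤ)) μ :=
  h.indep.precomp (g := Sum.inl) Sum.inl_injective

/-- For a fixed comparison index `t`, the vectors `(N e, X e t)` are independent over `e`. -/
lemma IsTMData.iIndepFun_pair (h : IsTMData μ T p u N X) (t : Fin T) :
    iIndepFun (fun e ω (b : Bool) => if b then (N e ω : ℤ) else X e t ω) μ := by
  -- The index `t` is fixed because all outcomes of a pair share its count: terms with different `t`
  -- for one pair are dependent.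
  let g : (_ : Pair n) × Bool → Pair n ⊕ (Pair n × Fin T) :=
    fun q => if q.2 then Sum.inl q.1 else Sum.inr (q.1, t)
  have hg : Function.Injective g := by
    rintro ⟨e, b⟩ ⟨e', b'⟩ hq
    cases b <;> cases b' <;> simp_all [g]
  have h1 := h.indep.precomp hg
  refine iIndepFun_curry (X := fun e (b : Bool) ω => if b then (N e ω : ℤ) else X e t ω)
    (fun e b => ?_) ?_
  · cases b
    · simpa using h.aemeasurable (Sum.inr (e, t))
    · simpa using h.aemeasurable (Sum.inl e)
  · convert! h1 using 2 with q
    obtain ⟨e, b⟩ := q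
    cases b <;> simp [g]

lemma IsTMData.indepFun_count_outcome (h : IsTMData μ T p u N X) (e : Pair n) (t : Fin T) :
    IndepFun (fun ω => (N e ω : ℤ)) (X e t) μ :=
  h.indep.indepFun (i := Sum.inl e) (j := Sum.inr (e, t)) (by simp)

lemma IsTMData.measureReal_card_le (hT : 1 ≤ T) (h : IsTMData μ T p u N X) (P : Finset (Pair n))
    (x : ℝ) :
    μ.real {ω | ((P.filter fun e => 0 < N e ω).card : ℝ) ≤ x} ≤
      Real.exp (x - p * P.card / 2) := by
  set Y : Pair n → Ω → ℝ := fun e ω => if 0 < N e ω then 1 else 0 with hY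
  have hmeas : ∀ e, AEMeasurable (Y e) μ := fun e => aemeasurable_ite_lt (h.law_count e) 0
  have hind : iIndepFun Y μ := by
    have := h.iIndepFun_count.comp (fun _ k => if 0 < k then (1 : ℝ) else 0)
      (fun _ => Measurable.of_discrete)
    convert! this using 2 with e
    funext ω
    simp [hY]
  have h1 : ∀ ω, ((P.filter fun e => 0 < N e ω).card : ℝ) = (∑ e ∈ P, Y e) ω := by
    intro ω
    rw [Finset.sum_apply, Finset.card_filter]
    push_cast
    rfl
  simp_rw [h1]
  refine (measure_le_le_exp_mul_mgf x (by norm_num : (-1 : ℝ) ≤ 0) ?_).trans ?_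
  · refine integrable_exp_mul_of_mem_Icc (a := 0) (b := P.card)
      (Finset.aemeasurable_sum P fun e _ => hmeas e) (ae_of_all _ fun ω => ?_)
    rw [← h1]
    exact ⟨Nat.cast_nonneg _, by exact_mod_cast Finset.card_filter_le _ _⟩
  · rw [hind.mgf_sum₀ hmeas, neg_neg, one_mul]
    refine (mul_le_mul_of_nonneg_left (Finset.prod_le_prod (fun _ _ => mgf_nonneg)
      fun e _ => mgf_ite_pos_neg_one_le hT (h.law_count e)) (Real.exp_pos _).le).trans_eq ?_
    rw [Finset.prod_const, ← Real.exp_nat_mul, ← Real.exp_add]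
    congr 1
    ring

/-- The contribution of the `t`-th comparisons to the score at `u` in the direction `w`. -/
def scoreTerm (u : Fin n → ℝ) (N : Pair n → Ω → ℕ) (X : Pair n → Fin T → Ω → ℤ) (t : Fin T)
    (w : Fin n → ℝ) (e : Pair n) (ω : Ω) : ℝ :=
  if (t : ℕ) < N e ω then score (X e t ω) (relScore u e) * relScore w e else 0

lemma scoreForm_eq_sum_scoreTerm (w : Fin n → ℝ) (ω : Ω) :
    scoreForm (fun e => N e ω) (fun e t => X e t ω) u w =
      ∑ t, (∑ e, scoreTerm u N X t w e) ω := by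
  simp_rw [Finset.sum_apply]
  rw [Finset.sum_comm]
  rfl

lemma IsTMData.aemeasurable_scoreTerm (h : IsTMData μ T p u N X) (t : Fin T) (w : Fin n → ℝ)
    (e : Pair n) : AEMeasurable (scoreTerm u N X t w e) μ :=
  (Measurable.of_discrete (f := fun q : ℕ × ℤ => if (t : ℕ) < q.1 then
    score q.2 (relScore u e) * relScore w e else 0)).comp_aemeasurable
      ((h.law_count e).aemeasurable.prodMk (h.law_outcome e t).aemeasurable)

lemma IsTMData.iIndepFun_scoreTerm (h : IsTMData μ T p u N X) (t : Fin T) (w : Fin n → ℝ) :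
    iIndepFun (scoreTerm u N X t w) μ := by
  have := (h.iIndepFun_pair t).comp (fun e (q : Bool → ℤ) => if (t : ℤ) < q true then
    score (q false) (relScore u e) * relScore w e else 0) (fun _ => Measurable.of_discrete)
  convert! this using 2 with e
  funext ω
  simp [scoreTerm]

lemma abs_scoreTerm_le {M : ℝ} (hM : ∀ e : Pair n, |relScore u e| ≤ M) (t : Fin T)
    (w : Fin n → ℝ) (e : Pair n) (ω : Ω) :
    |scoreTerm u N X t w e ω| ≤ Real.exp (M + 1 / 2) * |relScore w e| := by
  unfold scoreTerm
  split_ifs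
  · rw [abs_mul]
    gcongr
    exact abs_score_le _ (hM e)
  · rw [abs_zero]; positivity

/-- The exponential is `1 + I * J`, with `I` the indicator of an observed comparison and `J`
depending on the outcome only. Independence factors the expectation; `E I ≤ T p`, and `E J` is
quadratic in `s` as the score has mean zero. -/
lemma IsTMData.mgf_scoreTerm_le {M s : ℝ} (h : IsTMData μ T p u N X)
    (hM : ∀ e : Pair n, |relScore u e| ≤ M) (t : Fin T) (w : Fin n → ℝ) (e : Pair n)
    (hs : |s * relScore w e| * Real.exp (M + 1 / 2) ≤ 1) :
    mgf (scoreTerm u N X t w e) μ s ≤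
      Real.exp (T * p * (s * relScore w e * Real.exp (M + 1 / 2)) ^ 2) := by
  set I : Ω → ℝ := fun ω => if (t : ℕ) < N e ω then 1 else 0 with hI
  set J : Ω → ℝ := fun ω => Real.exp (s * relScore w e * score (X e t ω) (relScore u e)) - 1
    with hJ
  have h1 : mgf (scoreTerm u N X t w e) μ s = ∫ ω, (1 + I ω * J ω) ∂μ := by
    unfold mgf
    refine integral_congr_ae (ae_of_all _ fun ω => ?_)
    by_cases ht : (t : ℕ) < N e ω
    · simp only [scoreTerm, hI, hJ, ht, if_true]
      rw [one_mul, add_sub_cancel]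
      congr 1; ring
    · simp [scoreTerm, hI, ht]
  have hImeas : AEStronglyMeasurable I μ :=
    (aemeasurable_ite_lt (h.law_count e) t).aestronglyMeasurable
  have hJmeas : AEStronglyMeasurable J μ :=
    ((Measurable.of_discrete (f := fun x : ℤ => Real.exp (s * relScore w e *
      score x (relScore u e)) - 1)).comp_aemeasurable
        (h.law_outcome e t).aemeasurable).aestronglyMeasurable
  have hind : IndepFun I J μ := by
    have := (h.indepFun_count_outcome e t).comp
      (φ := fun k : ℤ => if (t : ℤ) < k then (1 : ℝ) else 0)
      (ψ := fun x : ℤ => Real.exp (s * relScore w e * score x (relScore u e)) - 1)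
      Measurable.of_discrete Measurable.of_discrete
    convert! this using 1
    funext ω
    simp [hI]
  have hJint : ∫ ω, J ω ∂μ ≤ (s * relScore w e * Real.exp (M + 1 / 2)) ^ 2 := by
    have := (h.law_outcome e t).integral_comp (f := fun x : ℤ => Real.exp (s * relScore w e *
      score x (relScore u e)) - 1) Measurable.of_discrete.aestronglyMeasurable
    exact this.trans_le (integral_exp_mul_score_sub_one_le (hM e) hs)
  have hI0 : 0 ≤ ∫ ω, I ω ∂μ := integral_nonneg fun ω => by
    simp only [hI]; split_ifs <;> simp
  have hint : Integrable (fun ω => I ω * J ω) μ := by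
    refine Integrable.of_bound (hImeas.mul hJmeas) (Real.exp 1 + 1) (ae_of_all _ fun ω => ?_)
    have h2 : |I ω| ≤ 1 := by simp only [hI]; split_ifs <;> simp
    have h3 : |J ω| ≤ Real.exp 1 + 1 := by
      have h4 : s * relScore w e * score (X e t ω) (relScore u e) ≤ 1 := by
        refine (le_abs_self _).trans (le_trans ?_ hs)
        rw [abs_mul]
        gcongr
        exact abs_score_le _ (hM e)
      have h5 := Real.exp_le_exp.2 h4
      have h6 := Real.exp_pos (s * relScore w e * score (X e t ω) (relScore u e))
      rw [abs_le]
      constructor <;> simp only [hJ] <;> linarith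
    rw [norm_mul, Real.norm_eq_abs, Real.norm_eq_abs]
    nlinarith [abs_nonneg (I ω), abs_nonneg (J ω)]
  rw [h1, integral_add (integrable_const _) hint,
    hind.integral_fun_mul_eq_mul_integral hImeas hJmeas]
  simp only [integral_const, probReal_univ, smul_eq_mul, mul_one]
  have h7 := integral_ite_lt_le (h.law_count e) t
  have h8 := Real.add_one_le_exp (T * p * (s * relScore w e * Real.exp (M + 1 / 2)) ^ 2)
  have h9 : (∫ ω, I ω ∂μ) * ∫ ω, J ω ∂μ ≤
      (T * p) * (s * relScore w e * Real.exp (M + 1 / 2)) ^ 2 :=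
    (mul_le_mul_of_nonneg_left hJint hI0).trans (mul_le_mul_of_nonneg_right h7 (sq_nonneg _))
  linarith

lemma sq_relScore_single_le (i : Fin n) (e : Pair n) :
    relScore (Pi.single i (1 : ℝ)) e ^ 2 ≤ 1 := by
  simp only [relScore, Pi.single_apply]
  split_ifs <;> norm_num

lemma sum_sq_relScore_single_le (i : Fin n) :
    ∑ e : Pair n, relScore (Pi.single i (1 : ℝ)) e ^ 2 ≤ 2 * n := by
  have h1 : ∀ e : Pair n, relScore (Pi.single i (1 : ℝ)) e ^ 2 ≤
      (if e.1.1 = i then 1 else 0) + (if e.1.2 = i then 1 else 0) := by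
    intro e
    simp only [relScore, Pi.single_apply]
    split_ifs <;> norm_num
  have hfst : (Finset.univ.filter fun e : Pair n => e.1.1 = i).card ≤ n := by
    refine (Finset.card_le_card_of_injOn (t := Finset.univ) (fun e : Pair n => e.1.2)
      (fun _ _ => Finset.mem_coe.2 (Finset.mem_univ _)) fun e he e' he' hee => ?_).trans_eq
      (by simp)
    simp only [Finset.coe_filter, Finset.mem_univ, true_and, Set.mem_ofPred_eq] at he he'
    exact Subtype.ext (Prod.ext (he.trans he'.symm) hee)
  have hsnd : (Finset.univ.filter fun e : Pair n => e.1.2 = i).card ≤ n := by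
    refine (Finset.card_le_card_of_injOn (t := Finset.univ) (fun e : Pair n => e.1.1)
      (fun _ _ => Finset.mem_coe.2 (Finset.mem_univ _)) fun e he e' he' hee => ?_).trans_eq
      (by simp)
    simp only [Finset.coe_filter, Finset.mem_univ, true_and, Set.mem_ofPred_eq] at he he'
    exact Subtype.ext (Prod.ext hee (he.trans he'.symm))
  refine (Finset.sum_le_sum fun e _ => h1 e).trans ?_
  rw [Finset.sum_add_distrib, Finset.sum_boole, Finset.sum_boole, two_mul]
  exact add_le_add (by exact_mod_cast hfst) (by exact_mod_cast hsnd)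

lemma IsTMData.measureReal_le_sum_scoreTerm {M s σ : ℝ} (h : IsTMData μ T p u N X)
    (hM : ∀ e : Pair n, |relScore u e| ≤ M) (hs0 : 0 ≤ s) (hs : s * Real.exp (M + 1 / 2) ≤ 1)
    (hσ : σ = 1 ∨ σ = -1) (t : Fin T) (i : Fin n) (z : ℝ) :
    μ.real {ω | z ≤ σ * (∑ e, scoreTerm u N X t (Pi.single i 1) e) ω} ≤
      Real.exp (2 * T * (n * p) * (s * Real.exp (M + 1 / 2)) ^ 2 - s * z) := by
  have hσ2 : σ ^ 2 = 1 := by obtain rfl | rfl := hσ <;> norm_num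
  have hmeas := h.aemeasurable_scoreTerm t (Pi.single i 1)
  refine (measure_ge_le_exp_mul_mgf (X := fun ω => σ * _) z hs0 ?_).trans ?_
  · refine integrable_exp_mul_of_mem_Icc
      (a := -∑ e : Pair n, Real.exp (M + 1 / 2) * |relScore (Pi.single i (1 : ℝ)) e|)
      (b := ∑ e : Pair n, Real.exp (M + 1 / 2) * |relScore (Pi.single i (1 : ℝ)) e|)
      ((Finset.aemeasurable_sum _ fun e _ => hmeas e).const_mul σ) (ae_of_all _ fun ω => ?_)
    rw [Set.mem_Icc, ← abs_le, abs_mul]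
    have : |σ| = 1 := by obtain rfl | rfl := hσ <;> simp
    rw [this, one_mul, Finset.sum_apply]
    exact (Finset.abs_sum_le_sum_abs _ _).trans
      (Finset.sum_le_sum fun e _ => abs_scoreTerm_le hM t _ e ω)
  · rw [mgf_const_mul, (h.iIndepFun_scoreTerm t (Pi.single i 1)).mgf_sum₀ hmeas]
    have hB := Real.exp_pos (M + 1 / 2)
    have hterm : ∀ e : Pair n, mgf (scoreTerm u N X t (Pi.single i 1) e) μ (σ * s) ≤
        Real.exp (T * p * (s * Real.exp (M + 1 / 2)) ^ 2 *
          relScore (Pi.single i (1 : ℝ)) e ^ 2) := by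
      intro e
      refine (h.mgf_scoreTerm_le hM t _ e ?_).trans_eq ?_
      · refine le_trans ?_ hs
        gcongr
        rw [abs_mul, abs_mul, abs_of_nonneg hs0]
        have h1 : |σ| = 1 := by obtain rfl | rfl := hσ <;> simp
        have h2 : |relScore (Pi.single i (1 : ℝ)) e| ≤ 1 :=
          (sq_le_one_iff_abs_le_one _).1 (sq_relScore_single_le i e)
        rw [h1, one_mul]
        exact mul_le_of_le_one_right hs0 h2
      · congr 1
        rw [mul_pow, mul_pow, mul_pow, hσ2]
        ring
    refine (mul_le_mul_of_nonneg_left (Finset.prod_le_prod (fun _ _ => mgf_nonneg)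
      fun e _ => hterm e) (Real.exp_pos _).le).trans ?_
    rw [← Real.exp_sum, ← Real.exp_add, ← Finset.mul_sum]
    apply Real.exp_le_exp.2
    have h3 := mul_le_mul_of_nonneg_left (sum_sq_relScore_single_le i)
      (by have := p.2.1; positivity : 0 ≤ T * (p : ℝ) * (s * Real.exp (M + 1 / 2)) ^ 2)
    linarith

end Concentration

/-! ### Vertex expansion of the comparison graph -/

section Expansion

variable {Ω : Type*} [MeasurableSpace Ω] {μ : Measure Ω} [IsProbabilityMeasure μ] {T n : ℕ}
  {p : unitInterval} {u : Fin n → ℝ} {N : Pair n → Ω → ℕ} {X : Pair n → Fin T → Ω → ℤ}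

/-- The pairs with one member in `A` and one in `D`. -/
def cutPairs (A D : Finset (Fin n)) : Finset (Pair n) :=
  Finset.univ.filter fun e => (e.1.1 ∈ A ∧ e.1.2 ∈ D) ∨ (e.1.1 ∈ D ∧ e.1.2 ∈ A)

lemma comparedPairs_eq_filter_cutPairs (K : Pair n → ℕ) (A D : Finset (Fin n)) :
    comparedPairs K A D = (cutPairs A D).filter fun e => 0 < K e := by
  rw [comparedPairs, cutPairs, Finset.filter_filter]
  exact Finset.filter_congr fun e _ => and_comm

lemma card_mul_card_le_card_cutPairs {A D : Finset (Fin n)} (h : Disjoint A D) :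
    A.card * D.card ≤ (cutPairs A D).card := by
  rw [← Finset.card_product]
  refine Finset.card_le_card_of_surjOn
    (fun e : Pair n => if e.1.1 ∈ A then (e.1.1, e.1.2) else (e.1.2, e.1.1)) ?_
  rintro ⟨a, d⟩ hq
  obtain ⟨ha, hd⟩ := Finset.mem_product.1 (Finset.mem_coe.1 hq)
  have hdA : d ∉ A := fun hh => Finset.disjoint_left.1 h hh hd
  obtain hlt | hlt := lt_or_gt_of_ne (fun hh : a = d => hdA (hh ▸ ha))
  · exact ⟨⟨(a, d), hlt⟩, by simp [cutPairs, ha, hd], by simp [ha]⟩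
  · exact ⟨⟨(d, a), hlt⟩, by simp [cutPairs, ha, hd], by simp [hdA]⟩

/-- A cut from `A` to the complement of `A'` has at least `#A * n / 2` pairs. By Chernoff, too few
compared pairs has probability at most `exp(-n p #A / 8)`, and `#A' ≤ G * #A` turns this into `n ^
(-8 #A')`, enough to sum over all `A` and `A'`. -/
lemma IsTMData.measureReal_not_hasExpansion_le (hT : 1 ≤ T) (hn : 2 ≤ n)
    (h : IsTMData μ T p u N X) :
    μ.real {ω | ¬ HasExpansion (fun e => N e ω) (n * p / (64 * Real.log n)) (n * p / 8)} ≤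
      9 / (n : ℝ) ^ 6 := by
  have hn0 : (0 : ℝ) < n := by positivity
  have hlog : 0 < Real.log n := Real.log_pos (by exact_mod_cast hn)
  have hp0 : (0 : ℝ) ≤ p := p.2.1
  set G : ℝ := n * p / (64 * Real.log n) with hG
  set L : ℝ := n * p / 8 with hL
  let bad : Finset (Fin n) × Finset (Fin n) → Set Ω := fun q =>
    {ω | q.1.Nonempty ∧ q.1 ⊆ q.2 ∧ 2 * q.2.card ≤ n ∧ (q.2.card : ℝ) ≤ G * q.1.card ∧
      ((comparedPairs (fun e => N e ω) q.1 q.2ᶜ).card : ℝ) < L * q.1.card}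
  have hsub : {ω | ¬ HasExpansion (fun e => N e ω) G L} ⊆ ⋃ q, bad q := by
    intro ω hω
    simp only [HasExpansion, Set.mem_ofPred_eq] at hω
    push Not at hω
    obtain ⟨A, A', h1, h2, h3, h4, h5⟩ := hω
    exact Set.mem_iUnion.2 ⟨(A, A'), h1, h2, h3, h4, h5⟩
  have hbad : ∀ q, μ.real (bad q) ≤
      (1 / (n : ℝ)) ^ 6 * ((1 / (n : ℝ)) ^ q.1.card * (1 / (n : ℝ)) ^ q.2.card) := by
    rintro ⟨A, A'⟩
    by_cases hq : A.Nonempty ∧ A ⊆ A' ∧ 2 * A'.card ≤ n ∧ (A'.card : ℝ) ≤ G * A.card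
    swap
    · have : bad (A, A') = ∅ := Set.eq_empty_of_forall_notMem fun ω hω =>
        hq ⟨hω.1, hω.2.1, hω.2.2.1, hω.2.2.2.1⟩
      rw [this, measureReal_empty]
      positivity
    obtain ⟨h1, h2, h3, h4⟩ := hq
    have hA : 1 ≤ A.card := h1.card_pos
    have hAA' := Finset.card_le_card h2
    have hcut : (A.card : ℝ) * (n / 2) ≤ (cutPairs A A'ᶜ).card := by
      have h6 := card_mul_card_le_card_cutPairs
        (A := A) (D := A'ᶜ) (disjoint_compl_right.mono_left h2)
      have h7 : A'ᶜ.card = n - A'.card := by rw [Finset.card_compl, Fintype.card_fin]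
      have h8 : (n : ℝ) / 2 ≤ (A'ᶜ.card : ℝ) := by
        rw [div_le_iff₀ two_pos]
        have : n ≤ A'ᶜ.card * 2 := by omega
        exact_mod_cast this
      calc (A.card : ℝ) * (n / 2) ≤ A.card * A'ᶜ.card := by gcongr
        _ ≤ _ := by exact_mod_cast h6
    have h9 : 8 * A'.card * Real.log n ≤ n * p * A.card / 8 := by
      rw [hG, div_mul_eq_mul_div, le_div_iff₀ (by positivity)] at h4
      linarith
    calc μ.real (bad (A, A')) ≤ μ.real {ω | (((cutPairs A A'ᶜ).filter
          fun e => 0 < N e ω).card : ℝ) ≤ L * A.card} := by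
          refine measureReal_mono fun ω hω => ?_
          have := hω.2.2.2.2
          rw [comparedPairs_eq_filter_cutPairs] at this
          exact this.le
      _ ≤ Real.exp (L * A.card - p * (cutPairs A A'ᶜ).card / 2) := h.measureReal_card_le hT _ _
      _ ≤ Real.exp ((8 * A'.card : ℕ) * -Real.log n) := by
          apply Real.exp_le_exp.2
          have := mul_le_mul_of_nonneg_left hcut hp0
          push_cast
          rw [hL]
          linarith
      _ = (1 / (n : ℝ)) ^ (8 * A'.card) := by
          rw [Real.exp_nat_mul, Real.exp_neg, Real.exp_log hn0, one_div]
      _ ≤ (1 / (n : ℝ)) ^ (6 + (A.card + A'.card)) := by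
          apply pow_le_pow_of_le_one (by positivity)
          · rw [div_le_one hn0]
            exact_mod_cast (by omega : 1 ≤ n)
          · omega
      _ = _ := by rw [pow_add, pow_add]
  -- By the binomial theorem the sum is `(1 + 1/n)^n`; two such factors give `e^2 ≤ 9`.
  have hsum : ∑ A : Finset (Fin n), (1 / (n : ℝ)) ^ A.card ≤ Real.exp 1 := by
    have h1 := Fin.sum_pow_mul_eq_add_pow (n := n) (1 / (n : ℝ)) 1
    simp only [one_pow, mul_one] at h1
    rw [h1]
    calc (1 / (n : ℝ) + 1) ^ n ≤ Real.exp (1 / n) ^ n := by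
          gcongr
          exact Real.add_one_le_exp _
      _ = Real.exp 1 := by
          rw [← Real.exp_nat_mul]
          congr 1
          field_simp
  have hsum0 : 0 ≤ ∑ A : Finset (Fin n), (1 / (n : ℝ)) ^ A.card :=
    Finset.sum_nonneg fun _ _ => by positivity
  calc _ ≤ μ.real (⋃ q, bad q) := measureReal_mono hsub
    _ ≤ ∑ q, μ.real (bad q) := measureReal_iUnion_fintype_le _
    _ ≤ ∑ q : Finset (Fin n) × Finset (Fin n),
        (1 / (n : ℝ)) ^ 6 * ((1 / (n : ℝ)) ^ q.1.card * (1 / (n : ℝ)) ^ q.2.card) :=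
        Finset.sum_le_sum fun q _ => hbad q
    _ = (1 / (n : ℝ)) ^ 6 * ((∑ A : Finset (Fin n), (1 / (n : ℝ)) ^ A.card) *
        ∑ A : Finset (Fin n), (1 / (n : ℝ)) ^ A.card) := by
        rw [← Finset.mul_sum, Fintype.sum_prod_type, Finset.sum_mul_sum]
    _ ≤ (1 / (n : ℝ)) ^ 6 * 9 := by
        gcongr
        have := Real.exp_one_lt_d9
        nlinarith
    _ = 9 / (n : ℝ) ^ 6 := by rw [div_pow, one_pow]; ring

end Expansion

/-! ### The finite-sample error bound -/

lemma MLEUniqueWithin.mono {T n : ℕ} {N : Pair n → ℕ} {X : Pair n → Fin T → ℤ} {u : Fin n → ℝ}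
    {r r' : ℝ} (h : MLEUniqueWithin N X u r) (hr : r ≤ r') : MLEUniqueWithin N X u r' :=
  ⟨h.1, fun v hv => (h.2 v hv).trans hr⟩

lemma abs_relScore_le_dynamicRange {n : ℕ} (u : Fin n → ℝ) (e : Pair n) :
    |relScore u e| ≤ dynamicRange u :=
  le_ciSup (f := fun e : Fin n × Fin n => |u e.1 - u e.2|) (Set.finite_range _).bddAbove e.1

lemma dynamicRange_nonneg {n : ℕ} (u : Fin n → ℝ) : 0 ≤ dynamicRange u :=
  Real.iSup_nonneg fun _ => abs_nonneg _

section FiniteSample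

variable {Ω : Type*} [MeasurableSpace Ω] {μ : Measure Ω} [IsProbabilityMeasure μ] {T n : ℕ}
  {p : unitInterval} {u : Fin n → ℝ} {N : Pair n → Ω → ℕ} {X : Pair n → Fin T → Ω → ℤ}

/-- All the scores of single subjects are of order `sqrt (n p log n)` with high probability. -/
lemma IsTMData.measureReal_scoreForm_le {M : ℝ} (hn : 2 ≤ n) (h : IsTMData μ T p u N X)
    (hM : ∀ e : Pair n, |relScore u e| ≤ M) (hnp : Real.log n ≤ n * p) :
    μ.real {ω | ¬ ∀ i, |scoreForm (fun e => N e ω) (fun e t => X e t ω) u (Pi.single i 1)| ≤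
      T * ((2 * T + 4) * Real.exp (M + 1 / 2) * Real.sqrt (n * p * Real.log n))} ≤
      2 * T / (n : ℝ) ^ 3 := by
  have hn0 : (0 : ℝ) < n := by positivity
  have hlog : 0 < Real.log n := Real.log_pos (by exact_mod_cast hn)
  have hx : 0 < (n : ℝ) * p := hlog.trans_le hnp
  set B := Real.exp (M + 1 / 2) with hB
  have hB0 : 0 < B := Real.exp_pos _
  set z := (2 * T + 4) * B * Real.sqrt (n * p * Real.log n) with hz
  -- With this Chernoff parameter the variance term is `2 T log n` and `s z = (2 T + 4) log n`,
  -- which leaves `n ^ (-4)` for the union bound over subjects, comparison indices and signs.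
  set s := Real.sqrt (Real.log n / (n * p)) / B with hs
  have hs0 : 0 ≤ s := by positivity
  have hsB : s * B = Real.sqrt (Real.log n / (n * p)) := div_mul_cancel₀ _ hB0.ne'
  have hsB1 : s * B ≤ 1 := by
    rw [hsB]
    exact Real.sqrt_le_one.2 ((div_le_one hx).2 hnp)
  have hsz : s * z = (2 * T + 4) * Real.log n := by
    have h1 : Real.sqrt (Real.log n / (n * p)) * Real.sqrt (n * p * Real.log n) = Real.log n := by
      rw [← Real.sqrt_mul (by positivity)]
      rw [show Real.log n / (n * p) * (n * p * Real.log n) = Real.log n ^ 2 by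
        rw [div_mul_eq_mul_div, mul_left_comm, mul_div_assoc, ← sq,
          mul_div_cancel₀ _ hx.ne']]
      exact Real.sqrt_sq hlog.le
    calc s * z = (2 * T + 4) * ((s * B) * Real.sqrt (n * p * Real.log n)) := by rw [hz]; ring
      _ = _ := by rw [hsB, h1]
  have hexp : Real.exp (2 * T * (n * p) * (s * B) ^ 2 - s * z) = 1 / (n : ℝ) ^ 4 := by
    rw [hsz, hsB, Real.sq_sqrt (by positivity)]
    rw [show 2 * T * (n * (p : ℝ)) * (Real.log n / (n * p)) - (2 * T + 4) * Real.log n =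
      (4 : ℕ) * -Real.log n by
        rw [mul_assoc _ _ (Real.log n / _), mul_div_cancel₀ _ hx.ne']; push_cast; ring]
    rw [Real.exp_nat_mul, Real.exp_neg, Real.exp_log hn0, inv_pow, one_div]
  let bad : Fin n × Fin T × Bool → Set Ω := fun q =>
    {ω | z ≤ (if q.2.2 then (1 : ℝ) else -1) *
      (∑ e, scoreTerm u N X q.2.1 (Pi.single q.1 1) e) ω}
  have hsub : {ω | ¬ ∀ i, |scoreForm (fun e => N e ω) (fun e t => X e t ω) u (Pi.single i 1)| ≤
      T * z} ⊆ ⋃ q, bad q := by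
    intro ω hω
    by_contra hcon
    apply hω
    intro i
    rw [scoreForm_eq_sum_scoreTerm]
    refine (Finset.abs_sum_le_sum_abs _ _).trans ?_
    refine (Finset.sum_le_card_nsmul _ _ z fun t _ => ?_).trans_eq (by simp)
    have h1 : ω ∉ bad (i, t, true) := fun hh => hcon (Set.mem_iUnion.2 ⟨_, hh⟩)
    have h2 : ω ∉ bad (i, t, false) := fun hh => hcon (Set.mem_iUnion.2 ⟨_, hh⟩)
    simp only [bad, Set.mem_ofPred_eq, not_le, if_true] at h1 h2
    rw [abs_le]
    constructor
    · rw [if_neg (by simp)] at h2; linarith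
    · linarith
  calc _ ≤ μ.real (⋃ q, bad q) := measureReal_mono hsub
    _ ≤ ∑ q, μ.real (bad q) := measureReal_iUnion_fintype_le _
    _ ≤ ∑ q : Fin n × Fin T × Bool, 1 / (n : ℝ) ^ 4 := by
        refine Finset.sum_le_sum fun q _ => ?_
        rw [← hexp]
        refine h.measureReal_le_sum_scoreTerm hM hs0 hsB1 ?_ q.2.1 q.1 z
        cases q.2.2 <;> simp
    _ = 2 * T / (n : ℝ) ^ 3 := by
        simp only [Finset.sum_const, Finset.card_univ, Fintype.card_prod, Fintype.card_fin,
          Fintype.card_bool, nsmul_eq_mul]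
        push_cast
        field_simp

lemma IsTMData.measureReal_not_mleUniqueWithin_le {b : ℝ} {k : ℕ} (hT : 1 ≤ T) (hn : 2 ≤ n)
    (hTn : T ≤ n) (h : IsTMData μ T p u N X) (hu : FirstZero u) (hnp : Real.log n ≤ n * p)
    (hk : (n : ℝ) < 2 * (n * p / (64 * Real.log n)) ^ k) (hb : 0 ≤ b) (hb1 : b ≤ 1)
    (hz : T * ((2 * T + 4) * Real.exp (dynamicRange u + 1 / 2) *
      Real.sqrt (n * p * Real.log n)) < minCurvature (dynamicRange u) * b * (n * p / 8)) :
    μ.real {ω | ¬ MLEUniqueWithin (fun e => N e ω) (fun e t => X e t ω) u (2 * k * b)} ≤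
      14 / (n : ℝ) ^ 2 := by
  have hn1 : (1 : ℝ) ≤ n := by exact_mod_cast (by omega : 1 ≤ n)
  have hlog : 0 < Real.log n := Real.log_pos (by exact_mod_cast hn)
  have hx : 0 < (n : ℝ) * p := hlog.trans_le hnp
  have hM := abs_relScore_le_dynamicRange u
  have h1 := h.measureReal_not_hasExpansion_le hT hn
  have h2 := h.measureReal_scoreForm_le hn hM hnp
  have h3 : μ.real {ω | ¬ ∀ e t, X e t ω = 1 ∨ X e t ω = -1} = 0 := by
    rw [measureReal_def, (ae_iff.1 h.ae_outcome), ENNReal.toReal_zero]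
  have hTn' : (T : ℝ) ≤ n := by exact_mod_cast hTn
  set S1 := {ω | ¬ HasExpansion (fun e => N e ω) (n * p / (64 * Real.log n)) (n * p / 8)}
  set S2 := {ω | ¬ ∀ i, |scoreForm (fun e => N e ω) (fun e t => X e t ω) u (Pi.single i 1)| ≤
      T * ((2 * T + 4) * Real.exp (dynamicRange u + 1 / 2) * Real.sqrt (n * p * Real.log n))}
  set S3 := {ω | ¬ ∀ e t, X e t ω = 1 ∨ X e t ω = -1}
  have hsub : {ω | ¬ MLEUniqueWithin (fun e => N e ω) (fun e t => X e t ω) u (2 * k * b)} ⊆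
      S1 ∪ S2 ∪ S3 := by
    intro ω hω
    by_contra hcon
    simp only [S1, S2, S3, Set.mem_union, Set.mem_ofPred_eq, not_or, not_not] at hcon
    exact hω (mleUniqueWithin_of_hasExpansion (by omega) hT hcon.2 hu hM (by positivity)
      hcon.1.1 (by positivity) hk hb hb1 hcon.1.2 hz)
  have h4 : 9 / (n : ℝ) ^ 6 ≤ 9 / (n : ℝ) ^ 2 := by
    gcongr
    norm_num
  have h5 : 2 * T / (n : ℝ) ^ 3 ≤ 2 / (n : ℝ) ^ 2 := by
    rw [div_le_div_iff₀ (by positivity) (by positivity)]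
    nlinarith [mul_le_mul_of_nonneg_right hTn' (sq_nonneg (n : ℝ))]
  have h6 : 9 / (n : ℝ) ^ 2 + 2 / (n : ℝ) ^ 2 ≤ 14 / (n : ℝ) ^ 2 := by
    rw [← add_div]; gcongr; norm_num
  calc _ ≤ μ.real (S1 ∪ S2 ∪ S3) := measureReal_mono hsub
    _ ≤ μ.real S1 + μ.real S2 + μ.real S3 :=
        (measureReal_union_le _ _).trans (by gcongr; exact measureReal_union_le _ _)
    _ ≤ _ := by linarith

end FiniteSample

/-! ### Asymptotics of the rates -/

/-- The analysis produces `exp(M^2)` without the prefactor `M`; the added `1` covers small `M` and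
is the source of the term `ρ` in the bound. -/
lemma exp_sq_mul_le (M : ℝ) (hM : 0 ≤ M) :
    Real.exp (M ^ 2) ≤ Real.exp 1 * (M * Real.exp (M ^ 2) + 1) := by
  have he := Real.one_lt_exp_iff.2 (zero_lt_one' ℝ)
  have h0 := Real.exp_pos (M ^ 2)
  obtain h | h := le_total 1 M
  · nlinarith [mul_le_mul_of_nonneg_right h h0.le]
  · have : Real.exp (M ^ 2) ≤ Real.exp 1 := Real.exp_le_exp.2 (by nlinarith)
    nlinarith [mul_nonneg hM h0.le]

lemma exp_le_minCurvature_mul (M : ℝ) :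
    Real.exp (M + 1 / 2) ≤
      minCurvature M * (2 * Real.pi * Real.exp 13 * Real.exp (M ^ 2)) := by
  have hpi : 0 < 2 * Real.pi := by positivity
  have h1 : minCurvature M * (2 * Real.pi) = Real.exp (-((M + 3) ^ 2) / 2) := by
    unfold minCurvature normalDensity
    have h2 : Real.sqrt (2 * Real.pi) ^ 2 = 2 * Real.pi := Real.sq_sqrt hpi.le
    have h3 : Real.sqrt (2 * Real.pi) ≠ 0 := by positivity
    rw [← h2]
    simp only [ne_eq, OfNat.ofNat_ne_zero, not_false_eq_true, zero_pow, neg_zero, zero_div,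
      Real.exp_zero, Real.sqrt_sq (Real.sqrt_nonneg _)]
    field_simp
  calc Real.exp (M + 1 / 2) ≤ Real.exp (-((M + 3) ^ 2) / 2 + 13 + M ^ 2) := by
        apply Real.exp_le_exp.2
        -- The constant `13` completes the square: the difference of the exponents is `(M - 4)^2 /
        -- 2`.
        nlinarith [sq_nonneg (M - 4)]
    _ = minCurvature M * (2 * Real.pi) * Real.exp 13 * Real.exp (M ^ 2) := by
        rw [h1, Real.exp_add, Real.exp_add]
    _ = _ := by ring

/-- If `sqrt (l / x) * (l / log x) ≤ 1 / 2` for large `l ≤ x`, then `l ^ 2 ≤ x`. -/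
lemma sq_le_of_rate_le {l x : ℝ} (hl : 256 ≤ l) (hlx : l ≤ x)
    (h : Real.sqrt (l / x) * (l / Real.log x) ≤ 1 / 2) : l ^ 2 ≤ x := by
  by_contra! hx
  have hl0 : 0 < l := by linarith
  have hx0 : 0 < x := by linarith
  have hlogx : 0 < Real.log x := Real.log_pos (by linarith)
  have h1 : Real.log x < 2 * Real.log l := by
    have := Real.log_lt_log hx0 hx
    rwa [Real.log_pow, Nat.cast_ofNat] at this
  have h2 : Real.log l ^ 2 ≤ l := by
    set m := Real.sqrt l with hm
    have hm2 : m ^ 2 = l := Real.sq_sqrt hl0.le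
    have hm16 : 16 ≤ m := Real.le_sqrt_of_sq_le (by linarith)
    set r := Real.sqrt m with hr
    have hr2 : r ^ 2 = m := Real.sq_sqrt (by linarith)
    have hr0 : 0 < r := Real.sqrt_pos.2 (by linarith)
    have h3 : Real.log l ≤ 4 * r := by
      rw [← hm2, ← hr2, ← pow_mul, Real.log_pow]
      have := Real.log_le_sub_one_of_pos hr0
      push_cast
      linarith
    have h4 : 0 ≤ Real.log l := Real.log_nonneg (by linarith)
    nlinarith
  have h5 : Real.sqrt (l / x) * (2 * l) ≤ Real.log x := by
    rw [← mul_div_assoc, div_le_iff₀ hlogx] at h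
    linarith
  have h6 : l / x * (4 * l ^ 2) ≤ Real.log x ^ 2 := by
    have := pow_le_pow_left₀ (by positivity) h5 2
    rw [mul_pow, Real.sq_sqrt (by positivity)] at this
    linarith
  have h7 : Real.log x ^ 2 < 4 * l := by nlinarith
  have h8 : l / x * (4 * l ^ 2) > 4 * l := by
    rw [gt_iff_lt, div_mul_eq_mul_div, lt_div_iff₀ hx0]
    nlinarith
  linarith

/-- The base dominates `y = x^(1/4)`, because `l ≤ sqrt x` and `64 ≤ y`; and `k * log y ≥ l`. -/
lemma le_pow_of_le {l x : ℝ} {k : ℕ} (hl : 4096 ≤ l) (hx : l ^ 2 ≤ x)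
    (hk : 4 * (l / Real.log x) ≤ k) : Real.exp l ≤ (x / (64 * l)) ^ k := by
  have hl0 : 0 < l := by linarith
  have hx0 : 0 < x := lt_of_lt_of_le (by positivity) hx
  have hlogx : 0 < Real.log x := Real.log_pos (by nlinarith)
  set m := Real.sqrt x with hm
  have hm2 : m ^ 2 = x := Real.sq_sqrt hx0.le
  have hml : l ≤ m := Real.le_sqrt_of_sq_le hx
  set y := Real.sqrt m with hy
  have hy2 : y ^ 2 = m := Real.sq_sqrt (by linarith)
  have hy64 : 64 ≤ y := Real.le_sqrt_of_sq_le (by linarith)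
  have hylog : Real.log x = 4 * Real.log y := by
    rw [← hm2, ← hy2, ← pow_mul, Real.log_pow]
    norm_num
  have h1 : y ≤ x / (64 * l) := by
    rw [le_div_iff₀ (by positivity), ← hm2]
    have h2 : 64 * l ≤ y * m := mul_le_mul hy64 hml hl0.le (by linarith)
    calc y * (64 * l) ≤ y * (y * m) := by gcongr
      _ = m ^ 2 := by rw [← mul_assoc, ← sq, hy2, sq]
  calc Real.exp l ≤ Real.exp (k * Real.log y) := by
        apply Real.exp_le_exp.2
        rw [← mul_div_assoc, div_le_iff₀ hlogx, hylog] at hk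
        linarith
    _ = y ^ k := by rw [Real.exp_nat_mul, Real.exp_log (by linarith)]
    _ ≤ _ := pow_le_pow_left₀ (by linarith) h1 k

/-- The constant in the error bound. -/
def errorConst (T : ℕ) : ℝ := 32 * T * (2 * T + 4) * (2 * Real.pi * Real.exp 13)

lemma errorConst_pos {T : ℕ} (hT : 1 ≤ T) : 0 < errorConst T := by
  have : (0 : ℝ) < T := by exact_mod_cast hT
  unfold errorConst
  positivity

section Rate

variable {Ω : Type*} [MeasurableSpace Ω] {μ : Measure Ω} [IsProbabilityMeasure μ] {T n : ℕ}
  {p : unitInterval} {u : Fin n → ℝ} {N : Pair n → Ω → ℕ} {X : Pair n → Fin T → Ω → ℤ}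

lemma IsTMData.measureReal_not_mleUniqueWithin_rate_le (hT : 1 ≤ T) (hTn : T ≤ n)
    (h : IsTMData μ T p u N X) (hu : FirstZero u) (hlog : 4096 ≤ Real.log n)
    (hnp : Real.log n ≤ n * p) (hrate : sparsityRate n p ≤ 1 / 2)
    (hDelta : errorConst T * Real.exp 1 *
      (tmRate n p (dynamicRange u) + sparsityRate n p) ≤ 1) :
    μ.real {ω | ¬ MLEUniqueWithin (fun e => N e ω) (fun e t => X e t ω) u
      (10 * (errorConst T * Real.exp 1) *
        (tmRate n p (dynamicRange u) + sparsityRate n p))} ≤ 14 / (n : ℝ) ^ 2 := by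
  have hn : 2 ≤ n := by
    by_contra! hh
    interval_cases n <;> norm_num at hlog
  have hn0 : (0 : ℝ) < n := by positivity
  have hT0 : (0 : ℝ) < T := by exact_mod_cast hT
  set M := dynamicRange u with hM
  set l := Real.log n with hl
  set x : ℝ := n * p with hx
  set C := errorConst T with hC
  have hC0 : 0 < C := errorConst_pos hT
  have hl0 : 0 < l := by linarith
  have hx0 : 0 < x := by linarith
  have hlogx : 0 < Real.log x := Real.log_pos (by linarith)
  -- The smallness of the rate forces `n p ≥ (log n)^2`, stronger than the assumed `n p ≥ log n`;
  -- this makes the expansion factor a power of `n p`.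
  have hxl : l ^ 2 ≤ x := sq_le_of_rate_le (by linarith) hnp hrate
  set s := Real.sqrt (l / x) with hs
  have hs0 : 0 < s := Real.sqrt_pos.2 (by positivity)
  have hratio : 1 ≤ l / Real.log x := by
    rw [le_div_iff₀ hlogx, one_mul]
    apply Real.log_le_log hx0
    exact mul_le_of_le_one_right hn0.le p.2.2
  have hρ : sparsityRate n p = s * (l / Real.log x) := rfl
  have hΔ : tmRate n p M = M * Real.exp (M ^ 2) * (s * (l / Real.log x)) := rfl
  have hsρ : s ≤ s * (l / Real.log x) := le_mul_of_one_le_right hs0.le hratio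
  have hmain : Real.exp (M ^ 2) * (s * (l / Real.log x)) ≤
      Real.exp 1 * (tmRate n p M + sparsityRate n p) := by
    rw [hρ, hΔ]
    have := mul_le_mul_of_nonneg_right (exp_sq_mul_le M (dynamicRange_nonneg u))
      (hs0.le.trans hsρ)
    linarith
  -- The layer width is chosen so that `minCurvature M * b * L` beats the score bound. The constant
  -- has a factor `4` to spare, which makes that inequality strict.
  set b := C * Real.exp (M ^ 2) * s with hb
  have hb0 : 0 ≤ b := by positivity
  have hbρ : b * (l / Real.log x) ≤
      C * Real.exp 1 * (tmRate n p M + sparsityRate n p) := by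
    have := mul_le_mul_of_nonneg_left hmain hC0.le
    rw [hb]
    linarith
  have hb1 : b ≤ 1 := by
    have := le_mul_of_one_le_right hb0 hratio
    linarith
  set k := ⌈4 * (l / Real.log x)⌉₊ with hk
  have hk1 : 4 * (l / Real.log x) ≤ k := Nat.le_ceil _
  -- The rounding error `1` is absorbed because `log n / log (n p) ≥ 1`.
  have hk2 : (k : ℝ) ≤ 5 * (l / Real.log x) := by
    have := Nat.ceil_lt_add_one (a := 4 * (l / Real.log x)) (by positivity)
    linarith
  have hnk : (n : ℝ) < 2 * (x / (64 * l)) ^ k := by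
    have := le_pow_of_le hlog hxl hk1
    rw [hl, Real.exp_log hn0] at this
    linarith
  have hz : T * ((2 * T + 4) * Real.exp (M + 1 / 2) * Real.sqrt (x * l)) <
      minCurvature M * b * (x / 8) := by
    have h1 : s * x = Real.sqrt (x * l) := by
      rw [hs, ← Real.sqrt_sq hx0.le, ← Real.sqrt_mul (by positivity), Real.sqrt_sq hx0.le]
      congr 1
      field_simp
    have h2 : 0 < Real.sqrt (x * l) := Real.sqrt_pos.2 (by positivity)
    have h3 := exp_le_minCurvature_mul M
    have h4 := Real.exp_pos (M + 1 / 2)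
    calc T * ((2 * T + 4) * Real.exp (M + 1 / 2) * Real.sqrt (x * l))
        < 4 * (T * ((2 * T + 4) * Real.exp (M + 1 / 2) * Real.sqrt (x * l))) := by
          have : 0 < T * ((2 * T + 4) * Real.exp (M + 1 / 2) * Real.sqrt (x * l)) := by
            positivity
          linarith
      _ ≤ 4 * (T * ((2 * T + 4) * (minCurvature M * (2 * Real.pi * Real.exp 13 *
          Real.exp (M ^ 2))) * Real.sqrt (x * l))) := by gcongr
      _ = minCurvature M * b * (x / 8) := by
          rw [hb, hC, errorConst, ← h1]
          ring
  have hr : 2 * k * b ≤ 10 * (C * Real.exp 1) * (tmRate n p M + sparsityRate n p) :=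
    calc 2 * k * b ≤ 2 * (5 * (l / Real.log x)) * b := by gcongr
      _ = 10 * (b * (l / Real.log x)) := by ring
      _ ≤ _ := by linarith
  refine le_trans (measureReal_mono ?_)
    (h.measureReal_not_mleUniqueWithin_le hT hn hTn hu hnp hnk hb0 hb1 hz)
  intro ω hω hh
  exact hω (MLEUniqueWithin.mono hh hr)

end Rate

/-! ### Passage to high-probability and almost sure statements -/

/-- Subadditivity replaces the complement rule, so the event need not be measurable. -/
lemma ofReal_one_sub_le_of_measureReal_le {Ω : Type*} [MeasurableSpace Ω] {μ : Measure Ω}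
    [IsProbabilityMeasure μ] {P : Ω → Prop} {r : ℝ} (h : μ.real {ω | ¬ P ω} ≤ r) :
    ENNReal.ofReal (1 - r) ≤ μ {ω | P ω} := by
  rw [ENNReal.ofReal_le_iff_le_toReal (measure_ne_top _ _), ← measureReal_def]
  have h1 : μ.real (Set.univ : Set Ω) ≤ μ.real {ω | P ω} + μ.real {ω | ¬ P ω} := by
    refine le_trans (measureReal_mono fun ω _ => ?_) (measureReal_union_le _ _)
    exact em (P ω)
  rw [probReal_univ] at h1
  linarith

/-- Borel–Cantelli. It uses no independence between different `n`, so their dependence may be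
arbitrary. -/
lemma ae_eventually_of_measureReal_not_le {Ω : Type*} [MeasurableSpace Ω] {μ : Measure Ω}
    [IsProbabilityMeasure μ] {P : ℕ → Ω → Prop} {c : ℝ}
    (h : ∀ᶠ n : ℕ in atTop, μ.real {ω | ¬ P n ω} ≤ c / (n : ℝ) ^ 2) :
    ∀ᵐ ω ∂μ, ∀ᶠ n in atTop, P n ω := by
  obtain ⟨n₀, hn₀⟩ := eventually_atTop.1 h
  have hsum : Summable fun n : ℕ => c / (n : ℝ) ^ 2 := by
    have := (Real.summable_one_div_nat_pow.2 one_lt_two).mul_left c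
    simpa [div_eq_mul_inv] using this
  -- Events with `n < n₀` are replaced by the empty set, since no bound is available there.
  have hle : ∀ n, μ {ω | n₀ ≤ n ∧ ¬ P n ω} ≤ ENNReal.ofReal (c / (n : ℝ) ^ 2) := by
    intro n
    by_cases hn : n₀ ≤ n
    · have h1 := hn₀ n hn
      simp only [hn, true_and]
      rw [← ENNReal.ofReal_toReal (measure_ne_top μ {ω | ¬ P n ω})]
      exact ENNReal.ofReal_le_ofReal h1
    · simp [hn]
  have htsum := ne_top_of_le_ne_top hsum.tsum_ofReal_ne_top (ENNReal.tsum_le_tsum hle)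
  filter_upwards [ae_eventually_notMem htsum] with ω hω
  filter_upwards [hω, eventually_ge_atTop n₀] with n hn hn'
  by_contra hcon
  exact hn ⟨hn', hcon⟩

end PairwiseComparison

end

theorem mainTheorem6 (T : ℕ) (hT : 1 ≤ T) :
    ∃ C : ℝ, 0 < C ∧
      ∀ {Ω : Type*} [MeasurableSpace Ω] (μ : Measure Ω) [IsProbabilityMeasure μ]
        (p : ℕ → unitInterval) (u : (n : ℕ) → Fin n → ℝ)
        (N : (n : ℕ) → PairwiseComparison.Pair n → Ω → ℕ)
        (X : (n : ℕ) → PairwiseComparison.Pair n → Fin T → Ω → ℤ)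
        (_hu : ∀ n, PairwiseComparison.FirstZero (u n))
        (_hdata : ∀ n, PairwiseComparison.IsTMData μ T (p n) (u n) (N n) (X n))
        (_hp : ∃ c : ℝ, 1 < c ∧ ∀ᶠ n : ℕ in atTop, c * (Real.log n / n) ≤ (p n : ℝ))
        (_hrate : Tendsto (fun n : ℕ => PairwiseComparison.sparsityRate n (p n)) atTop (𝓝 0))
        (_hDelta : Tendsto (fun n : ℕ => PairwiseComparison.tmRate n (p n)
          (PairwiseComparison.dynamicRange (u n))) atTop (𝓝 0)),
      -- for large `n`, with probability at least `1 - 14 / n ^ 2`, the MLE uniquely exists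
      -- and its sup-norm error is at most `C (Δ_n + ρ_n)`
      (∀ᶠ n : ℕ in atTop,
        ENNReal.ofReal (1 - 14 / (n : ℝ) ^ 2) ≤
          μ {ω | PairwiseComparison.MLEUniqueWithin (fun e => N n e ω) (fun e t => X n e t ω) (u n)
            (C * (PairwiseComparison.tmRate n (p n) (PairwiseComparison.dynamicRange (u n)) +
              PairwiseComparison.sparsityRate n (p n)))}) ∧
      -- almost surely, the same holds for all but finitely many `n`
      (∀ᵐ ω ∂μ, ∀ᶠ n : ℕ in atTop,
        PairwiseComparison.MLEUniqueWithin (fun e => N n e ω) (fun e t => X n e t ω) (u n)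
          (C * (PairwiseComparison.tmRate n (p n) (PairwiseComparison.dynamicRange (u n)) +
            PairwiseComparison.sparsityRate n (p n)))) ∧
      -- the MLE is (strongly) uniformly consistent
      (∀ uhat : (n : ℕ) → Ω → Fin n → ℝ,
        (∀ n ω, (∃ v, PairwiseComparison.IsMLE (fun e => N n e ω) (fun e t => X n e t ω) v) →
          PairwiseComparison.IsMLE (fun e => N n e ω) (fun e t => X n e t ω) (uhat n ω)) →
        ∀ᵐ ω ∂μ, Tendsto (fun n : ℕ => ‖uhat n ω - u n‖) atTop (𝓝 0)) := by
  refine ⟨10 * (PairwiseComparison.errorConst T * Real.exp 1), ?_, ?_⟩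
  · have := PairwiseComparison.errorConst_pos hT
    positivity
  intro Ω _ μ _ p u N X hu hdata hp hrate hDelta
  have hsum := hDelta.add hrate
  rw [add_zero] at hsum
  have hprob : ∀ᶠ n : ℕ in atTop,
      μ.real {ω | ¬ PairwiseComparison.MLEUniqueWithin (fun e => N n e ω) (fun e t => X n e t ω)
        (u n) (10 * (PairwiseComparison.errorConst T * Real.exp 1) *
          (PairwiseComparison.tmRate n (p n) (PairwiseComparison.dynamicRange (u n)) +
            PairwiseComparison.sparsityRate n (p n)))} ≤ 14 / (n : ℝ) ^ 2 := by
    obtain ⟨c, hc, hpc⟩ := hp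
    have hlim := hsum.const_mul (PairwiseComparison.errorConst T * Real.exp 1)
    rw [mul_zero] at hlim
    filter_upwards [hpc, eventually_ge_atTop T, eventually_ge_atTop 1,
      (Real.tendsto_log_atTop.comp tendsto_natCast_atTop_atTop).eventually_ge_atTop 4096,
      hrate.eventually_le_const (by norm_num : (0 : ℝ) < 1 / 2),
      hlim.eventually_le_const zero_lt_one] with n h1 h2 h3 h4 h5 h6
    refine (hdata n).measureReal_not_mleUniqueWithin_rate_le hT h2 (hu n) h4 ?_ h5 h6
    have hn0 : (0 : ℝ) < n := by exact_mod_cast h3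
    have hlog : 4096 ≤ Real.log n := h4
    rw [← mul_div_assoc, div_le_iff₀ hn0] at h1
    -- Since `c > 1`, the density assumption gives `log n ≤ n p`.
    nlinarith
  have hae := PairwiseComparison.ae_eventually_of_measureReal_not_le hprob
  refine ⟨?_, hae, fun uhat huhat => ?_⟩
  · filter_upwards [hprob] with n hn
    exact PairwiseComparison.ofReal_one_sub_le_of_measureReal_le hn
  · have hlim := hsum.const_mul (10 * (PairwiseComparison.errorConst T * Real.exp 1))
    rw [mul_zero] at hlim
    filter_upwards [hae] with ω hω
    refine squeeze_zero' (Eventually.of_forall fun n => norm_nonneg _) ?_ hlim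
    filter_upwards [hω] with n hn
    exact hn.2 _ (huhat n ω hn.1.exists)
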